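/- Let $N\subset\mathbb T^8=(S^1)^8$ be the kernel of the homomorphism $\mathbb T^8\to\mathbb T^2$ which sends the standard generators, in order, to $(-1,0),(-1,-1),(0,-1),(1,-1),(1,0),(1,1),(0,1),(-1,1)$, acting on $\mathbb C^8$ by rotating the coordinates, and let $M=L/N$ be the compact $4$-manifold obtained by (Delzant) reduction of $$L=\Bigl\{z\in\mathbb C^8:\ |z_1|^2+|z_5|^2=6,\ |z_2|^2+|z_5|^2+|z_7|^2=10,\ |z_3|^2+|z_7|^2=6,\ |z_4|^2-|z_5|^2+|z_7|^2=4,\ |z_5|^2-|z_6|^2+|z_7|^2=2,\ |z_5|^2-|z_7|^2+|z_8|^2=4\Bigr\}.$$ The smooth structure is given by the eight charts in which six cyclically consecutive coordinates are normalised to be positive by the $N$-action and the other two are the coordinates of the chart. Write $[z_1,\dots,z_8]$ for the class of $z$ in $M$. On $M$ put $$J=\tfrac12|z_1|^2,\qquad H=\tfrac12|z_3|^2,\qquad X=\operatorname{Re}(\overline{z_2}\,\overline{z_3}\,\overline{z_4}\,z_6z_7z_8).$$ Let $\gamma>0$ and, for $t\in[0,1]$, $H_t=(1-2t)H+t\gamma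 X$ and $F_t=(J,H_t):M\to\mathbb R^2$. A fixed point of $F_t$ is a point of rank zero, i.e. a point $p$ with $dF_t(p)=0$. Let $$\mathfrak f(\zeta)=(2+\zeta)(6+\zeta)(8-\zeta)(4-\zeta)(2-\zeta).$$ (1) There are exactly two smooth functions $u:[0,1]\to[-\sqrt2,\sqrt2]$ such that, for all $t\in[0,1]$, $u=u(t)$ satisfies $$(1-2t)\,u\sqrt{\mathfrak f(u^2)}+\gamma t\,\mathfrak f(u^2)+\gamma t\,u^2\,\mathfrak f'(u^2)=0 .$$ They are denoted by $u_-,u_+$, where $u_-(0)=0$ and $u_+(0)=\sqrt2$. There are exactly two smooth functions $v:[0,1]\to[-\sqrt2,\sqrt2]$ such that, for all $t\in[0,1]$, $v=v(t)$ satisfies $$-(1-2t)\,v\sqrt{\mathfrak f(v^2)}+\gamma t\,\mathfrak f(v^2)+\gamma t\,v^2\,\mathfrak f'(v^2)=0 .$$ They are denoted by $v_-,v_+$, where $v_-(0)=-\sqrt2$ and $v_+(0)=0$. (2) For every $t\in[0,1]$, $F_t$ has exactly eight fixed points. Four of them do not depend on $t$: $$A=[\sqrt2,\sqrt6,\sqrt6,2\sqrt2,2,\sqrt2,0,0],\quad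 B=[\sqrt2,0,0,\sqrt2,2,2\sqrt2,\sqrt6,\sqrt6],$$ $$C=[2,2\sqrt2,\sqrt6,\sqrt6,\sqrt2,0,0,\sqrt2],\quad D=[2,\sqrt2,0,0,\sqrt2,\sqrt6,\sqrt6,2\sqrt2].$$ The other four are $P_t^{min}=P(u_-(t))$, $P_t^{max}=P(u_+(t))$, $Q_t^{min}=Q(v_-(t))$, $Q_t^{max}=Q(v_+(t))$, where $$P(u)=\bigl[0,\,u,\sqrt{2+u^2},\sqrt{6+u^2},\sqrt6,\sqrt{8-u^2},\sqrt{4-u^2},\sqrt{2-u^2}\bigr],$$ $$Q(v)=\bigl[\sqrt6,\sqrt{8-v^2},\sqrt{4-v^2},\sqrt{2-v^2},\,0,\,v,\sqrt{2+v^2},\sqrt{6+v^2}\bigr].$$ (3) For $t=0$ these four points are $$P_0^{min}=[0,0,\sqrt2,\sqrt6,\sqrt6,2\sqrt2,2,\sqrt2],\quad P_0^{max}=[0,\sqrt2,2,2\sqrt2,\sqrt6,\sqrt6,\sqrt2,0],$$ $$Q_0^{min}=[\sqrt6,\sqrt6,\sqrt2,0,0,\sqrt2,2,2\sqrt2],\quad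 Q_0^{max}=[\sqrt6,2\sqrt2,2,\sqrt2,0,0,\sqrt2,\sqrt6].$$ -/

import Mathlib

open scoped ContDiff Manifold

noncomputable section

namespace OctagonSystem

/-! ### The toric manifold of the octagon

The coordinates `z₁, …, z₈` are indexed by `Fin 8`, i.e. `z k` stands for the `(k+1)`-st one, and
index arithmetic in `Fin 8` is modulo `8`. -/

/-- The primitive outer normals of the eight edges, counterclockwise from the left edge. -/
def normal : Fin 8 → ℤ × ℤ :=
  ![(-1, 0), (-1, -1), (0, -1), (1, -1), (1, 0), (1, 1), (0, 1), (-1, 1)]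

/-- The right hand sides `c k` of the inequalities `⟨p, normal k⟩ ≤ c k` defining the octagon. -/
def offset : Fin 8 → ℝ := ![0, -1, 0, 2, 3, 5, 3, 2]

/-- The homomorphism `𝕋⁸ → 𝕋²` sending the standard basis to the outer normals. -/
def torusMap : (Fin 8 → Circle) →* Circle × Circle where
  toFun g := (∏ k, g k ^ (normal k).1, ∏ k, g k ^ (normal k).2)
  map_one' := by simp
  map_mul' g h := by simp [mul_zpow, Finset.prod_mul_distrib]

/-- The `6`-dimensional torus by which one reduces. -/
def N : Subgroup (Fin 8 → Circle) := torusMap.ker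

/-- The zero level set of the momentum map `ℂ⁸ → ℝ⁶` of the action of `N`. -/
def levelSet : Set (Fin 8 → ℂ) :=
  {z | ‖z 0‖ ^ 2 + ‖z 4‖ ^ 2 = 6 ∧
       ‖z 1‖ ^ 2 + ‖z 4‖ ^ 2 + ‖z 6‖ ^ 2 = 10 ∧
       ‖z 2‖ ^ 2 + ‖z 6‖ ^ 2 = 6 ∧
       ‖z 3‖ ^ 2 - ‖z 4‖ ^ 2 + ‖z 6‖ ^ 2 = 4 ∧
       ‖z 4‖ ^ 2 - ‖z 5‖ ^ 2 + ‖z 6‖ ^ 2 = 2 ∧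
       ‖z 4‖ ^ 2 - ‖z 6‖ ^ 2 + ‖z 7‖ ^ 2 = 4}

/-- `N` acts on the level set by rotating the coordinates. -/
instance : MulAction N levelSet where
  smul g z := ⟨fun k => (g.1 k : ℂ) * z.1 k, by
    have h := z.2
    simpa only [levelSet, Set.mem_ofPred_eq, norm_mul, Circle.norm_coe, one_mul] using h⟩
  one_smul z := Subtype.ext (funext fun k => by
    change ((1 : Circle) : ℂ) * z.1 k = z.1 k
    simp)
  mul_smul g h z := Subtype.ext (funext fun k => by
    change ((g.1 k * h.1 k : Circle) : ℂ) * z.1 k = (g.1 k : ℂ) * ((h.1 k : ℂ) * z.1 k)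
    simp [mul_assoc])

lemma smul_apply (g : N) (z : levelSet) (k : Fin 8) : (g • z).1 k = (g.1 k : ℂ) * z.1 k := rfl

/-- The reduced space, with the quotient topology. -/
def M : Type := Quotient (MulAction.orbitRel N levelSet)

instance : TopologicalSpace M :=
  inferInstanceAs (TopologicalSpace (Quotient (MulAction.orbitRel N levelSet)))

/-- The class `[z₁, …, z₈]`. -/
def M.mk (z : levelSet) : M := Quotient.mk _ z

/-- Functions on the level set that are invariant under `N` descend to `M`. -/
def M.lift {α : Type*} (f : levelSet → α) (hf : ∀ (g : N) (z : levelSet), f (g • z) = f z) :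
    M → α :=
  Quotient.lift f (by rintro _ z ⟨g, rfl⟩; exact hf g z)

lemma M.lift_mk {α : Type*} (f : levelSet → α) (hf) (z : levelSet) :
    M.lift f hf (M.mk z) = f z := rfl

lemma M.mk_eq {z w : levelSet} (g : N) (h : g • z = w) : M.mk w = M.mk z :=
  Quotient.sound ⟨g, h⟩

lemma M.mk_surj (p : M) : ∃ z, M.mk z = p := Quotient.exists_rep p

/-- The point `[x₁, …, x₈]` for real `x₁, …, x₈` that satisfy the manifold equations. -/
def realPoint (x : Fin 8 → ℝ)
    (h : x 0 ^ 2 + x 4 ^ 2 = 6 ∧ x 1 ^ 2 + x 4 ^ 2 + x 6 ^ 2 = 10 ∧ x 2 ^ 2 + x 6 ^ 2 = 6 ∧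
      x 3 ^ 2 - x 4 ^ 2 + x 6 ^ 2 = 4 ∧ x 4 ^ 2 - x 5 ^ 2 + x 6 ^ 2 = 2 ∧
      x 4 ^ 2 - x 6 ^ 2 + x 7 ^ 2 = 4) : M :=
  M.mk ⟨fun k => (x k : ℂ), by
    simpa only [levelSet, Set.mem_ofPred_eq, Complex.norm_real, Real.norm_eq_abs, sq_abs] using h⟩

def A : M := realPoint ![√2, √6, √6, 2 * √2, 2, √2, 0, 0] (by simp [mul_pow]; norm_num)

lemma isQuotientMap_mk : Topology.IsQuotientMap M.mk := isQuotientMap_quotient_mk'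

/-! ### Charts -/

/-- The modulus of a coordinate. -/
def modulus (k : Fin 8) : M → ℝ :=
  M.lift (fun z => ‖z.1 k‖) (fun g z => by simp [smul_apply, Circle.norm_coe])

/-- The six indices different from `ν` and `ν + 1`. -/
def others (ν : Fin 8) : Finset (Fin 8) := {ν, ν + 1}ᶜ

/-- The open set where only the coordinates `ν` and `ν + 1` may vanish. -/
def U (ν : Fin 8) : Set M := {p | ∀ k ∈ others ν, modulus k p ≠ 0}

def cross (a b : ℤ × ℤ) : ℤ := a.1 * b.2 - a.2 * b.1

/-- The coordinates of `normal k` in the basis `normal ν, normal (ν + 1)` of `ℤ²`. -/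
def expo₁ (ν k : Fin 8) : ℤ := cross (normal k) (normal (ν + 1))

def expo₂ (ν k : Fin 8) : ℤ := cross (normal ν) (normal k)

def phase (z : ℂ) : ℂ := z / ‖z‖

/-- The values of the coordinates `ν` and `ν + 1` after the other six have been rotated to the
positive real axis by means of the action of `N`. -/
def chartMap (ν : Fin 8) (z : Fin 8 → ℂ) : ℂ × ℂ :=
  (z ν * ∏ k ∈ others ν, phase (z k) ^ expo₁ ν k,
   z (ν + 1) * ∏ k ∈ others ν, phase (z k) ^ expo₂ ν k)

/-- The squared modulus of the coordinate `k`, in terms of the coordinates `ν` and `ν + 1`. -/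
def sqModulus (ν : Fin 8) (w : ℂ × ℂ) (k : Fin 8) : ℝ :=
  2 * offset k + expo₁ ν k * (‖w.1‖ ^ 2 - 2 * offset ν)
    + expo₂ ν k * (‖w.2‖ ^ 2 - 2 * offset (ν + 1))

/-- The range of the chart with domain `U ν`. -/
def V (ν : Fin 8) : Set (ℂ × ℂ) := {w | ∀ k ∈ others ν, 0 < sqModulus ν w k}

/-- The representative whose coordinates other than `ν` and `ν + 1` are positive real numbers. -/
def slice (ν : Fin 8) (w : ℂ × ℂ) (k : Fin 8) : ℂ :=
  if k = ν then w.1 else if k = ν + 1 then w.2 else (√(sqModulus ν w k) : ℂ)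

lemma mem_others {ν k : Fin 8} : k ∈ others ν ↔ k ≠ ν ∧ k ≠ ν + 1 := by
  simp [others]

lemma ne_add_one (ν : Fin 8) : ν ≠ ν + 1 := by revert ν; decide

lemma prod_split {G : Type*} [CommMonoid G] (ν : Fin 8) (f : Fin 8 → G) :
    ∏ k, f k = f ν * f (ν + 1) * ∏ k ∈ others ν, f k := by
  rw [← Finset.prod_mul_prod_compl {ν, ν + 1} f, Finset.prod_pair (ne_add_one ν)]
  rfl

lemma normal_fst (ν k : Fin 8) :
    (normal k).1 = expo₁ ν k * (normal ν).1 + expo₂ ν k * (normal (ν + 1)).1 := by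
  revert ν k; decide

lemma normal_snd (ν k : Fin 8) :
    (normal k).2 = expo₁ ν k * (normal ν).2 + expo₂ ν k * (normal (ν + 1)).2 := by
  revert ν k; decide

lemma expo_self (ν : Fin 8) :
    expo₁ ν ν = 1 ∧ expo₁ ν (ν + 1) = 0 ∧ expo₂ ν ν = 0 ∧ expo₂ ν (ν + 1) = 1 := by
  revert ν; decide

lemma prod_zpow_lin (g : Fin 8 → Circle) (hg : g ∈ N) (a b : ℤ) :
    ∏ k, g k ^ (a * (normal k).1 + b * (normal k).2) = 1 := by
  have h : torusMap g = 1 := hg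
  have h1 : ∏ k, g k ^ (normal k).1 = 1 := congrArg Prod.fst h
  have h2 : ∏ k, g k ^ (normal k).2 = 1 := congrArg Prod.snd h
  have : ∀ k, g k ^ (a * (normal k).1 + b * (normal k).2)
      = (g k ^ (normal k).1) ^ a * (g k ^ (normal k).2) ^ b := fun k => by
    rw [zpow_add, ← zpow_mul, ← zpow_mul, mul_comm a, mul_comm b]
  simp only [this, Finset.prod_mul_distrib, Finset.prod_zpow, h1, h2, one_zpow, mul_one]

lemma prod_expo₁ (g : Fin 8 → Circle) (hg : g ∈ N) (ν : Fin 8) :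
    g ν * ∏ k ∈ others ν, g k ^ expo₁ ν k = 1 := by
  have h := prod_zpow_lin g hg (normal (ν + 1)).2 (-(normal (ν + 1)).1)
  have e : ∀ k, (normal (ν + 1)).2 * (normal k).1 + -(normal (ν + 1)).1 * (normal k).2
      = expo₁ ν k := fun k => by simp only [expo₁, cross]; ring
  simp only [e] at h
  rw [prod_split ν, (expo_self ν).1, (expo_self ν).2.1] at h
  simpa using h

lemma prod_expo₂ (g : Fin 8 → Circle) (hg : g ∈ N) (ν : Fin 8) :
    g (ν + 1) * ∏ k ∈ others ν, g k ^ expo₂ ν k = 1 := by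
  have h := prod_zpow_lin g hg (-(normal ν).2) (normal ν).1
  have e : ∀ k, -(normal ν).2 * (normal k).1 + (normal ν).1 * (normal k).2
      = expo₂ ν k := fun k => by simp only [expo₂, cross]; ring
  simp only [e] at h
  rw [prod_split ν, (expo_self ν).2.2.1, (expo_self ν).2.2.2] at h
  simpa using h

lemma phase_smul (g : Circle) (z : ℂ) : phase (g * z) = g * phase z := by
  simp [phase, mul_div_assoc, Circle.norm_coe]

lemma prod_phase (g : Fin 8 → Circle) (z : Fin 8 → ℂ) (ν : Fin 8) (e : Fin 8 → ℤ) :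
    ∏ k ∈ others ν, phase (g k * z k) ^ e k
      = ((∏ k ∈ others ν, g k ^ e k : Circle) : ℂ) * ∏ k ∈ others ν, phase (z k) ^ e k := by
  have hc : ((∏ k ∈ others ν, g k ^ e k : Circle) : ℂ) = ∏ k ∈ others ν, (g k : ℂ) ^ e k := by
    exact map_prod Circle.coeHom (fun k => g k ^ e k) (others ν)
  rw [hc, ← Finset.prod_mul_distrib]
  refine Finset.prod_congr rfl fun k _ => ?_
  rw [phase_smul, mul_zpow]

lemma chartMap_smul (ν : Fin 8) (g : N) (z : levelSet) :
    chartMap ν (g • z).1 = chartMap ν z.1 := by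
  have h1 := congrArg (fun x : Circle => (x : ℂ)) (prod_expo₁ g.1 g.2 ν)
  have h2 := congrArg (fun x : Circle => (x : ℂ)) (prod_expo₂ g.1 g.2 ν)
  simp only [Circle.coe_mul, Circle.coe_one] at h1 h2
  simp only [chartMap, smul_apply, prod_phase]
  refine Prod.ext ?_ ?_
  · linear_combination (z.1 ν * ∏ k ∈ others ν, phase (z.1 k) ^ expo₁ ν k) * h1
  · linear_combination (z.1 (ν + 1) * ∏ k ∈ others ν, phase (z.1 k) ^ expo₂ ν k) * h2

/-- The chart on `U ν`. -/
def chartFun (ν : Fin 8) : M → ℂ × ℂ := M.lift (fun z => chartMap ν z.1) (chartMap_smul ν)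

lemma norm_sq_eq {z : Fin 8 → ℂ} (hz : z ∈ levelSet) (ν k : Fin 8) :
    ‖z k‖ ^ 2 = sqModulus ν (z ν, z (ν + 1)) k := by
  obtain ⟨h1, h2, h3, h4, h5, h6⟩ := hz
  fin_cases ν <;> fin_cases k <;>
    simp [sqModulus, offset, expo₁, expo₂, cross, normal] <;> linarith

lemma mem_levelSet_of {z : Fin 8 → ℂ} (ν : Fin 8)
    (h : ∀ k, ‖z k‖ ^ 2 = sqModulus ν (z ν, z (ν + 1)) k) : z ∈ levelSet := by
  have h0 := h 0
  have h1 := h 1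
  have h2 := h 2
  have h3 := h 3
  have h4 := h 4
  have h5 := h 5
  have h6 := h 6
  have h7 := h 7
  clear h
  fin_cases ν <;>
    simp [sqModulus, offset, expo₁, expo₂, cross, normal] at h0 h1 h2 h3 h4 h5 h6 h7 <;>
    refine ⟨?_, ?_, ?_, ?_, ?_, ?_⟩ <;> linarith

lemma slice_fst (ν : Fin 8) (w : ℂ × ℂ) : slice ν w ν = w.1 := by simp [slice]

lemma slice_snd (ν : Fin 8) (w : ℂ × ℂ) : slice ν w (ν + 1) = w.2 := by
  simp [slice, (ne_add_one ν).symm]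

lemma slice_other {ν k : Fin 8} (hk : k ∈ others ν) (w : ℂ × ℂ) :
    slice ν w k = (√(sqModulus ν w k) : ℂ) := by
  rw [mem_others] at hk
  simp [slice, hk.1, hk.2]

lemma slice_mem {ν : Fin 8} {w : ℂ × ℂ} (hw : w ∈ V ν) : slice ν w ∈ levelSet := by
  refine mem_levelSet_of ν fun k => ?_
  rw [slice_fst, slice_snd]
  by_cases hk : k ∈ others ν
  · rw [slice_other hk, Complex.norm_real, Real.norm_eq_abs, sq_abs,
      Real.sq_sqrt (hw k hk).le]
  · rw [mem_others, not_and_or, not_not, not_not] at hk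
    obtain ⟨e1, e2, e3, e4⟩ := expo_self ν
    rcases hk with rfl | rfl
    · rw [slice_fst]; simp [sqModulus, e1, e3]
    · rw [slice_snd]; simp [sqModulus, e2, e4]

open Classical in
/-- The inverse of the chart on `U ν` (an arbitrary value is taken outside `V ν`). -/
def chartInv (ν : Fin 8) (w : ℂ × ℂ) : M :=
  if hw : w ∈ V ν then M.mk ⟨slice ν w, slice_mem hw⟩
  else A

lemma chartInv_of_mem {ν : Fin 8} {w : ℂ × ℂ} (hw : w ∈ V ν) :
    chartInv ν w = M.mk ⟨slice ν w, slice_mem hw⟩ := by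
  simp [chartInv, hw]

lemma norm_phase {z : ℂ} (hz : z ≠ 0) : ‖phase z‖ = 1 := by
  simp [phase, hz]

lemma phase_ofReal {x : ℝ} (hx : 0 < x) : phase x = 1 := by
  simp [phase, abs_of_pos hx, hx.ne']

lemma norm_prod_phase {z : Fin 8 → ℂ} {ν : Fin 8} (hz : ∀ k ∈ others ν, z k ≠ 0)
    (e : Fin 8 → ℤ) : ‖∏ k ∈ others ν, phase (z k) ^ e k‖ = 1 := by
  rw [norm_prod]
  refine Finset.prod_eq_one fun k hk => ?_
  rw [norm_zpow, norm_phase (hz k hk), one_zpow]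

lemma mk_mem_U {ν : Fin 8} {z : levelSet} : M.mk z ∈ U ν ↔ ∀ k ∈ others ν, z.1 k ≠ 0 := by
  simp [U, modulus, M.lift_mk]

lemma sqModulus_chartMap {z : levelSet} {ν : Fin 8} (hz : ∀ k ∈ others ν, z.1 k ≠ 0)
    (k : Fin 8) : sqModulus ν (chartMap ν z.1) k = ‖z.1 k‖ ^ 2 := by
  rw [norm_sq_eq z.2 ν k]
  simp only [sqModulus, chartMap, norm_mul, norm_prod_phase hz, mul_one]

lemma chartMap_mem {z : levelSet} {ν : Fin 8} (hz : ∀ k ∈ others ν, z.1 k ≠ 0) :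
    chartMap ν z.1 ∈ V ν := fun k hk => by
  rw [sqModulus_chartMap hz]
  have := norm_pos_iff.2 (hz k hk)
  positivity

lemma exists_circle {z : ℂ} (hz : z ≠ 0) : ∃ c : Circle, (c : ℂ) = phase z :=
  ⟨⟨phase z, mem_sphere_zero_iff_norm.2 (norm_phase hz)⟩, rfl⟩

lemma mem_N_of (ν : Fin 8) (c : Fin 8 → Circle) (g : Fin 8 → Circle)
    (h1 : g ν = ∏ k ∈ others ν, c k ^ expo₁ ν k)
    (h2 : g (ν + 1) = ∏ k ∈ others ν, c k ^ expo₂ ν k)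
    (h : ∀ k ∈ others ν, g k = (c k)⁻¹) : g ∈ N := by
  have key : ∀ m : Fin 8 → ℤ, (∀ k, m k = expo₁ ν k * m ν + expo₂ ν k * m (ν + 1)) →
      ∏ k, g k ^ m k = 1 := fun m hm => by
    rw [prod_split ν, h1, h2, ← Finset.prod_zpow, ← Finset.prod_zpow, ← Finset.prod_mul_distrib,
      ← Finset.prod_mul_distrib]
    refine Finset.prod_eq_one fun k hk => ?_
    rw [h k hk, inv_zpow', ← zpow_mul, ← zpow_mul, ← zpow_add, ← zpow_add, ← hm k,
      add_neg_cancel, zpow_zero]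
  exact Prod.ext (key _ (normal_fst ν)) (key _ (normal_snd ν))

lemma chart_left_inv {ν : Fin 8} {z : levelSet} (hz : ∀ k ∈ others ν, z.1 k ≠ 0) :
    chartInv ν (chartMap ν z.1) = M.mk z := by
  rw [chartInv_of_mem (chartMap_mem hz)]
  have hc : ∀ k, ∃ c : Circle, k ∈ others ν → (c : ℂ) = phase (z.1 k) := fun k => by
    by_cases hk : k ∈ others ν
    · obtain ⟨c, h⟩ := exists_circle (hz k hk)
      exact ⟨c, fun _ => h⟩
    · exact ⟨1, fun h => absurd h hk⟩
  choose c hc using hc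
  have hprod : ∀ e : Fin 8 → ℤ, ((∏ k ∈ others ν, c k ^ e k : Circle) : ℂ)
      = ∏ k ∈ others ν, phase (z.1 k) ^ e k := fun e => by
    refine (map_prod Circle.coeHom (fun k => c k ^ e k) (others ν)).trans ?_
    refine Finset.prod_congr rfl fun k hk => ?_
    rw [← hc k hk]
    exact Circle.coe_zpow _ _
  let g : Fin 8 → Circle := fun k =>
    if k = ν then ∏ j ∈ others ν, c j ^ expo₁ ν j
    else if k = ν + 1 then ∏ j ∈ others ν, c j ^ expo₂ ν j else (c k)⁻¹
  have g1 : g ν = ∏ k ∈ others ν, c k ^ expo₁ ν k := by simp [g]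
  have g2 : g (ν + 1) = ∏ k ∈ others ν, c k ^ expo₂ ν k := by
    simp [g, (ne_add_one ν).symm]
  have g3 : ∀ k ∈ others ν, g k = (c k)⁻¹ := fun k hk => by
    rw [mem_others] at hk
    simp [g, hk.1, hk.2]
  refine M.mk_eq ⟨g, mem_N_of ν c g g1 g2 g3⟩ (Subtype.ext (funext fun k => ?_))
  rw [smul_apply]
  change (g k : ℂ) * z.1 k = slice ν (chartMap ν z.1) k
  by_cases hk : k ∈ others ν
  · rw [slice_other hk, sqModulus_chartMap hz, Real.sqrt_sq (norm_nonneg _), g3 k hk,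
      Circle.coe_inv, hc k hk, phase]
    have := hz k hk
    field_simp
  · rw [mem_others, not_and_or, not_not, not_not] at hk
    rcases hk with rfl | rfl
    · rw [slice_fst, g1, hprod, mul_comm]; rfl
    · rw [slice_snd, g2, hprod, mul_comm]; rfl

lemma chart_right_inv {ν : Fin 8} {w : ℂ × ℂ} (hw : w ∈ V ν) :
    chartMap ν (slice ν w) = w := by
  have : ∀ e : Fin 8 → ℤ, ∏ k ∈ others ν, phase (slice ν w k) ^ e k = 1 := fun e =>
    Finset.prod_eq_one fun k hk => by
      rw [slice_other hk, phase_ofReal (Real.sqrt_pos.2 (hw k hk)), one_zpow]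
  simp only [chartMap, this, slice_fst, slice_snd, mul_one]

lemma continuous_modulus (k : Fin 8) : Continuous (modulus k) := by
  rw [isQuotientMap_mk.continuous_iff]
  exact ((continuous_apply k).comp continuous_subtype_val).norm

lemma isOpen_U (ν : Fin 8) : IsOpen (U ν) := by
  have : U ν = ⋂ k ∈ others ν, {p | modulus k p ≠ 0} := by ext; simp [U]
  rw [this]
  exact isOpen_biInter_finset fun k _ => isOpen_ne_fun (continuous_modulus k) continuous_const

lemma contDiff_sqModulus (ν k : Fin 8) : ContDiff ℝ ∞ fun w => sqModulus ν w k := by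
  unfold sqModulus
  have h1 : ContDiff ℝ ∞ fun w : ℂ × ℂ => ‖w.1‖ ^ 2 := contDiff_fst.norm_sq ℝ
  have h2 : ContDiff ℝ ∞ fun w : ℂ × ℂ => ‖w.2‖ ^ 2 := contDiff_snd.norm_sq ℝ
  fun_prop

lemma isOpen_V (ν : Fin 8) : IsOpen (V ν) := by
  have : V ν = ⋂ k ∈ others ν, {w | 0 < sqModulus ν w k} := by ext; simp [V]
  rw [this]
  exact isOpen_biInter_finset fun k _ =>
    isOpen_lt continuous_const (contDiff_sqModulus ν k).continuous

lemma contDiffOn_slice (ν k : Fin 8) : ContDiffOn ℝ ∞ (fun w => slice ν w k) (V ν) := by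
  by_cases hk : k ∈ others ν
  · simp only [slice_other hk]
    exact Complex.ofRealCLM.contDiff.comp_contDiffOn
      ((contDiff_sqModulus ν k).contDiffOn.sqrt fun w hw => (hw k hk).ne')
  · rw [mem_others, not_and_or, not_not, not_not] at hk
    rcases hk with rfl | rfl
    · simp only [slice_fst]; exact contDiff_fst.contDiffOn
    · simp only [slice_snd]; exact contDiff_snd.contDiffOn

lemma contDiffAt_phase {z : ℂ} (hz : z ≠ 0) : ContDiffAt ℝ ∞ phase z := by
  have h : ContDiffAt ℝ ∞ (fun z : ℂ => ((‖z‖ : ℝ) : ℂ)) z :=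
    Complex.ofRealCLM.contDiff.contDiffAt.comp z (contDiffAt_norm ℝ hz)
  have e : phase = fun z : ℂ => z * ((‖z‖ : ℝ) : ℂ)⁻¹ := funext fun z => div_eq_mul_inv _ _
  rw [e]
  exact contDiffAt_id.mul (h.inv (Complex.ofReal_ne_zero.2 (norm_ne_zero_iff.2 hz)))

lemma contDiffAt_zpow {E : Type*} [NormedAddCommGroup E] [NormedSpace ℝ E] {f : E → ℂ} {x : E}
    (hf : ContDiffAt ℝ ∞ f x) (h0 : f x ≠ 0) (m : ℤ) : ContDiffAt ℝ ∞ (fun y => f y ^ m) x := by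
  cases m with
  | ofNat n => simpa using hf.pow n
  | negSucc n =>
    simp only [zpow_negSucc]
    exact (hf.pow (n + 1)).inv (pow_ne_zero _ h0)

lemma contDiffAt_chartMap {ν : Fin 8} {z : Fin 8 → ℂ} (hz : ∀ k ∈ others ν, z k ≠ 0) :
    ContDiffAt ℝ ∞ (chartMap ν) z := by
  have hk : ∀ k, ContDiffAt ℝ ∞ (fun z : Fin 8 → ℂ => z k) z := fun k =>
    (contDiff_apply ℝ ℂ k).contDiffAt
  have hp : ∀ e : Fin 8 → ℤ,
      ContDiffAt ℝ ∞ (fun z : Fin 8 → ℂ => ∏ k ∈ others ν, phase (z k) ^ e k) z := fun e => by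
    refine contDiffAt_prod fun k hk' => contDiffAt_zpow ?_ ?_ _
    · exact ContDiffAt.comp z (contDiffAt_phase (hz k hk')) (hk k)
    · exact norm_ne_zero_iff.1 (by rw [norm_phase (hz k hk')]; exact one_ne_zero)
  exact ((hk _).mul (hp _)).prodMk ((hk _).mul (hp _))

lemma continuousOn_chartFun (ν : Fin 8) : ContinuousOn (chartFun ν) (U ν) := by
  refine (isQuotientMap_mk.continuousOn_isOpen_iff (g := chartFun ν) (isOpen_U ν)).2 ?_
  intro z hz
  have hz' : ∀ k ∈ others ν, z.1 k ≠ 0 := mk_mem_U.1 hz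
  exact ((contDiffAt_chartMap hz').continuousAt.comp
    continuous_subtype_val.continuousAt).continuousWithinAt

lemma continuousOn_chartInv (ν : Fin 8) : ContinuousOn (chartInv ν) (V ν) := by
  rw [continuousOn_iff_continuous_domRestrict]
  have h : (V ν).domRestrict (chartInv ν)
      = fun w : V ν => M.mk ⟨slice ν w.1, slice_mem w.2⟩ :=
    funext fun w => chartInv_of_mem w.2
  rw [h]
  refine isQuotientMap_mk.continuous.comp (Continuous.subtype_mk ?_ _)
  exact continuous_pi fun k =>
    continuousOn_iff_continuous_domRestrict.1 (contDiffOn_slice ν k).continuousOn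

/-- The chart with domain `U ν`. -/
def chart (ν : Fin 8) : OpenPartialHomeomorph M (ℂ × ℂ) where
  toFun := chartFun ν
  invFun := chartInv ν
  source := U ν
  target := V ν
  map_source' p hp := by
    obtain ⟨z, rfl⟩ := p.mk_surj
    exact chartMap_mem (mk_mem_U.1 hp)
  map_target' w hw := by
    rw [chartInv_of_mem hw, mk_mem_U]
    intro k hk
    change slice ν w k ≠ 0
    rw [slice_other hk, Complex.ofReal_ne_zero]
    exact (Real.sqrt_pos.2 (hw k hk)).ne'
  left_inv' p hp := by
    obtain ⟨z, rfl⟩ := p.mk_surj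
    exact chart_left_inv (mk_mem_U.1 hp)
  right_inv' w hw := by
    rw [chartInv_of_mem hw]
    exact chart_right_inv hw
  open_source := isOpen_U ν
  open_target := isOpen_V ν
  continuousOn_toFun := continuousOn_chartFun ν
  continuousOn_invFun := continuousOn_chartInv ν

lemma adjacent_of_zero {z : Fin 8 → ℂ} (hz : z ∈ levelSet) {i j : Fin 8} (hi : z i = 0)
    (hj : z j = 0) : j = i ∨ j = i + 1 ∨ i = j + 1 := by
  obtain ⟨h1, h2, h3, h4, h5, h6⟩ := hz
  have hi' : ‖z i‖ ^ 2 = 0 := by simp [hi]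
  have hj' : ‖z j‖ ^ 2 = 0 := by simp [hj]
  have p0 := sq_nonneg ‖z 0‖
  have p1 := sq_nonneg ‖z 1‖
  have p2 := sq_nonneg ‖z 2‖
  have p3 := sq_nonneg ‖z 3‖
  have p4 := sq_nonneg ‖z 4‖
  have p5 := sq_nonneg ‖z 5‖
  have p6 := sq_nonneg ‖z 6‖
  have p7 := sq_nonneg ‖z 7‖
  clear hi hj
  fin_cases i <;> fin_cases j <;>
    first
    | decide
    | (exfalso
       simp only [Fin.mk_zero, Fin.mk_one, Fin.reduceFinMk, Fin.isValue]
        at hi' hj'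
       linarith)

lemma exists_mem_U (p : M) : ∃ ν, p ∈ U ν := by
  obtain ⟨z, rfl⟩ := p.mk_surj
  simp only [mk_mem_U, mem_others]
  by_cases h : ∃ i, z.1 i = 0
  · obtain ⟨i, hi⟩ := h
    by_cases h' : ∃ j, i = j + 1 ∧ z.1 j = 0
    · obtain ⟨j, rfl, hj⟩ := h'
      refine ⟨j, fun k hk h0 => ?_⟩
      have a := adjacent_of_zero z.2 hj h0
      have b := adjacent_of_zero z.2 hi h0
      clear hi hj h0
      revert j k
      decide
    · refine ⟨i, fun k hk h0 => ?_⟩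
      rcases adjacent_of_zero z.2 hi h0 with a | a | a
      · exact hk.1 a
      · exact hk.2 a
      · exact h' ⟨k, a, h0⟩
  · exact ⟨0, fun k _ h0 => h ⟨k, h0⟩⟩

/-- `M` as a manifold of real dimension `4`. -/
instance : ChartedSpace (ℂ × ℂ) M where
  atlas := Set.range chart
  chartAt p := chart (exists_mem_U p).choose
  mem_chart_source p := (exists_mem_U p).choose_spec
  chart_mem_atlas _ := ⟨_, rfl⟩

instance : IsManifold 𝓘(ℝ, ℂ × ℂ) ∞ M := by
  refine isManifold_of_contDiffOn _ _ _ ?_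
  rintro _ _ ⟨ν, rfl⟩ ⟨μ, rfl⟩
  simp only [modelWithCornersSelf_coe, modelWithCornersSelf_coe_symm, Set.range_id,
    Set.inter_univ, Set.preimage_id, Function.comp_id, Function.id_comp]
  rintro w ⟨hw, hw'⟩
  have hw1 : w ∈ V ν := hw
  have hw2 : chartInv ν w ∈ U μ := hw'
  rw [chartInv_of_mem hw1, mk_mem_U] at hw2
  have hc : ContDiffAt ℝ ∞ (fun x => chartMap μ (slice ν x)) w :=
    ContDiffAt.comp w (contDiffAt_chartMap hw2) (contDiffAt_pi.2 fun k =>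
      (contDiffOn_slice ν k).contDiffAt ((isOpen_V ν).mem_nhds hw1))
  refine (hc.congr_of_eventuallyEq ?_).contDiffWithinAt
  filter_upwards [(isOpen_V ν).mem_nhds hw1] with x hx
  change chartFun μ (chartInv ν x) = _
  rw [chartInv_of_mem hx]
  rfl

/-! ### The momentum map -/

def J (p : M) : ℝ := modulus 0 p ^ 2 / 2

def H (p : M) : ℝ := modulus 2 p ^ 2 / 2

/-- `Z = conj z₂ * conj z₃ * conj z₄ * z₆ * z₇ * z₈`. -/
def Z : M → ℂ :=
  M.lift (fun z => star (z.1 1) * star (z.1 2) * star (z.1 3) * z.1 5 * z.1 6 * z.1 7)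
    (fun g z => by
      have h := prod_zpow_lin g.1 g.2 0 1
      simp only [normal, Fin.prod_univ_eight] at h
      simp at h
      have h' := congrArg (fun x : Circle => (x : ℂ)) h
      simp only [Circle.coe_mul, Circle.coe_inv_eq_conj, Circle.coe_one] at h'
      simp only [smul_apply, star_mul', RCLike.star_def]
      linear_combination ((starRingEnd ℂ) (z.1 1) * (starRingEnd ℂ) (z.1 2) * (starRingEnd ℂ) (z.1 3)
        * z.1 5 * z.1 6 * z.1 7) * h')

def X (p : M) : ℝ := (Z p).re

/-- `H_t = (1 - 2t) H + t γ X`. -/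
def Ht (γ t : ℝ) (p : M) : ℝ := (1 - 2 * t) * H p + t * γ * X p

def Ft (γ t : ℝ) (p : M) : ℝ × ℝ := (J p, Ht γ t p)

/-- A fixed point is a point of rank zero, i.e. one where the differential exists and is zero. -/
def IsFixedPoint (F : M → ℝ × ℝ) (p : M) : Prop :=
  HasMFDerivAt 𝓘(ℝ, ℂ × ℂ) 𝓘(ℝ, ℝ × ℝ) F p 0

/-! ### The points -/

def B : M := realPoint ![√2, 0, 0, √2, 2, 2 * √2, √6, √6] (by simp [mul_pow]; norm_num)
def C : M := realPoint ![2, 2 * √2, √6, √6, √2, 0, 0, √2] (by simp [mul_pow]; norm_num)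
def D : M := realPoint ![2, √2, 0, 0, √2, √6, √6, 2 * √2] (by simp [mul_pow]; norm_num)
def Pmin : M := realPoint ![0, 0, √2, √6, √6, 2 * √2, 2, √2] (by simp [mul_pow]; norm_num)
def Pmax : M := realPoint ![0, √2, 2, 2 * √2, √6, √6, √2, 0] (by simp [mul_pow]; norm_num)
def Qmin : M := realPoint ![√6, √6, √2, 0, 0, √2, 2, 2 * √2] (by simp [mul_pow]; norm_num)
def Qmax : M := realPoint ![√6, 2 * √2, 2, √2, 0, 0, √2, √6] (by simp [mul_pow]; norm_num)

/-- The interval `[-√2, √2]`. -/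
abbrev I₂ : Set ℝ := Set.Icc (-√2) √2

lemma sq_le_two (u : I₂) : (u : ℝ) ^ 2 ≤ 2 := by
  have h := abs_le.2 u.2
  calc (u : ℝ) ^ 2 = |(u : ℝ)| ^ 2 := (sq_abs _).symm
    _ ≤ √2 ^ 2 := by gcongr
    _ = 2 := by simp

/-- The points from which `P_t^min` and `P_t^max` are obtained. -/
def pointP (u : I₂) : M :=
  realPoint ![0, u, √(2 + u ^ 2), √(6 + u ^ 2), √6, √(8 - u ^ 2), √(4 - u ^ 2), √(2 - u ^ 2)] (by
    have h := sq_le_two u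
    have h0 := sq_nonneg (u : ℝ)
    simp
    rw [Real.sq_sqrt (by linarith), Real.sq_sqrt (by linarith), Real.sq_sqrt (by linarith),
      Real.sq_sqrt (by linarith), Real.sq_sqrt (by linarith)]
    refine ⟨?_, ?_, ?_, ?_, ?_⟩ <;> ring)

/-- The points from which `Q_t^min` and `Q_t^max` are obtained. -/
def pointQ (v : I₂) : M :=
  realPoint ![√6, √(8 - v ^ 2), √(4 - v ^ 2), √(2 - v ^ 2), 0, v, √(2 + v ^ 2), √(6 + v ^ 2)] (by
    have h := sq_le_two v
    have h0 := sq_nonneg (v : ℝ)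
    simp
    rw [Real.sq_sqrt (by linarith), Real.sq_sqrt (by linarith), Real.sq_sqrt (by linarith),
      Real.sq_sqrt (by linarith), Real.sq_sqrt (by linarith)]
    refine ⟨?_, ?_, ?_, ?_, ?_⟩ <;> ring)

/-! ### The equations for `u` and `v` -/

/-- The polynomial `𝔣`. -/
def f (ζ : ℝ) : ℝ := (2 + ζ) * (6 + ζ) * (8 - ζ) * (4 - ζ) * (2 - ζ)

def eqU (γ t u : ℝ) : Prop :=
  (1 - 2 * t) * u * √(f (u ^ 2)) + γ * t * f (u ^ 2) + γ * t * u ^ 2 * deriv f (u ^ 2) = 0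

def eqV (γ t v : ℝ) : Prop :=
  -(1 - 2 * t) * v * √(f (v ^ 2)) + γ * t * f (v ^ 2) + γ * t * v ^ 2 * deriv f (v ^ 2) = 0

/-- `u : [0, 1] → [-√2, √2]` is smooth (up to the end points) and `E t (u t)` holds for all `t`. -/
def IsSmoothSolution (E : ℝ → ℝ → Prop) (u : Set.Icc (0 : ℝ) 1 → I₂) : Prop :=
  ContDiffOn ℝ ∞ (Set.IccExtend zero_le_one fun t : Set.Icc (0 : ℝ) 1 => (u t : ℝ)) (Set.Icc 0 1) ∧
    ∀ t : Set.Icc (0 : ℝ) 1, E t (u t)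

end OctagonSystem

end

open OctagonSystem

open scoped ContDiff Manifold

noncomputable section

namespace OctagonSystem

/-! ### Zeros of a rotating family of linear combinations -/

/-! At a fixed point the differential of `J` vanishes. In the chart on `U ν`, `J` is affine in the
squared moduli of the two coordinates, so every coordinate with a nonzero coefficient is zero
(`coordinates_of_isFixedPoint`). This leaves `A`, `B`, `C`, `D` and the spheres `z 0 = 0` and `z 4 =
0`. At the four vertices `F_t` is even in the chart, hence critical for all `t`. Along the spheres
it is even in the normal direction, so only the restriction of `H_t` matters. Up to a constant this
is `±(1 - 2t)|w|²/2 + tγ Re(w) √(f(|w|²))`; a critical `w` is real and satisfies `eqU` or `eqV`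
(`hasFDerivAt_profile_iff`). The pole `|w|² = 2`, missing from this chart, is tested in a
neighbouring one and is critical only for `t = 0`.

To count solutions, put `u = √2 sin θ`, which removes the singularity of the root at the poles. With
`g ζ = ζ f ζ` and `ζ = 2 sin² θ`, the equation becomes `(1 - 2t) S + γ t D = 0`, where `S² = g ζ`
and `D = g' ζ`. Strict concavity of `√g` means that the Wronskian of `S` and `D` is negative
(`wronskian_neg`). So `D / S` decreases from `+∞` to `-∞` on each half of the `θ`-interval: for `0 <
t ≤ 1` there is one zero in each half, it is simple, and the implicit function theorem makes it
smooth in `t`, up to `t = 0` (`exists_smooth_zero`). The equation for `v` reduces to that for `u` by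
`v = -u`.

At `t = 0` there is the further root `-√2`. It gives no new point, since `±√2` define the same class
in `M`, and no new smooth solution, since by continuity a solution is determined by its values for
`t > 0`. -/

/-- If both combinations vanished, the vector `(1 - 2t, γ t)`, which is never zero, would lie in the
kernel of a matrix with nonzero determinant. This makes the zeros of the pencil simple. -/
lemma pencil_deriv_ne_zero {γ t S D S' D' : ℝ} (hγ : 0 < γ) (hW : S * D' - S' * D < 0)
    (h : (1 - 2 * t) * S + γ * t * D = 0) : (1 - 2 * t) * S' + γ * t * D' ≠ 0 := by
  intro h'
  have h1 : (1 - 2 * t) * (S * D' - S' * D) = 0 := by linear_combination D' * h - D * h'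
  have h2 : γ * t * (S * D' - S' * D) = 0 := by linear_combination S * h' - S' * h
  have h3 : 1 - 2 * t = 0 := (mul_eq_zero.1 h1).resolve_right hW.ne
  have h4 : γ * t = 0 := (mul_eq_zero.1 h2).resolve_right hW.ne
  have h5 : t = 0 := (mul_eq_zero.1 h4).resolve_left hγ.ne'
  rw [h5] at h3
  norm_num at h3

/-- The zeros of `(1 - 2t) S + γ t D` when the curve `(S, D)` turns clockwise. -/
theorem exists_smooth_zero {S D : ℝ → ℝ} {a b γ : ℝ} (hγ : 0 < γ) (hab : a < b)
    (hS : ContDiff ℝ ∞ S) (hD : ContDiff ℝ ∞ D)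
    (hW : ∀ θ, S θ * deriv D θ - deriv S θ * D θ < 0)
    (hSa : S a = 0) (hSb : S b = 0) (hSpos : ∀ θ ∈ Set.Ioo a b, 0 < S θ)
    (hSneg : ∀ θ ∈ Set.Icc b (b + 1), S θ ≤ 0) (hDa : 0 < D a) (hDb : D b < 0) :
    ∃ Θ : ℝ → ℝ, Θ 0 = b ∧ ContDiffOn ℝ ∞ Θ (Set.Icc 0 1) ∧
      ∀ t ∈ Set.Ioc (0 : ℝ) 1, Θ t ∈ Set.Ioo a b ∧
        ∀ θ ∈ Set.Icc a b, (1 - 2 * t) * S θ + γ * t * D θ = 0 ↔ θ = Θ t := by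
  have hSd : Differentiable ℝ S := hS.differentiable (by simp)
  have hDd : Differentiable ℝ D := hD.differentiable (by simp)
  -- The derivative of `D / S` is the Wronskian divided by `S ^ 2`.
  have anti : StrictAntiOn (fun θ => D θ / S θ) (Set.Ioo a b) := by
    refine strictAntiOn_of_deriv_neg (convex_Ioo a b)
      (hDd.continuous.continuousOn.div hSd.continuous.continuousOn
        fun θ hθ => (hSpos θ hθ).ne') fun θ hθ => ?_
    rw [interior_Ioo] at hθ
    have hp := hSpos θ hθ
    have hd := (hDd θ).hasDerivAt.div (hSd θ).hasDerivAt hp.ne'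
    have e : (fun θ => D θ / S θ) = D / S := rfl
    rw [e, hd.deriv]
    refine div_neg_of_neg_of_pos ?_ (by positivity)
    have := hW θ
    linarith
  have mem : ∀ t ∈ Set.Ioc (0 : ℝ) 1, ∀ θ ∈ Set.Icc a b,
      (1 - 2 * t) * S θ + γ * t * D θ = 0 → θ ∈ Set.Ioo a b := by
    intro t ht θ hθ h
    have hgt : 0 < γ * t := mul_pos hγ ht.1
    refine ⟨lt_of_le_of_ne hθ.1 ?_, lt_of_le_of_ne hθ.2 ?_⟩
    · rintro rfl
      rw [hSa] at h
      have := mul_pos hgt hDa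
      linarith
    · rintro rfl
      rw [hSb] at h
      have := mul_neg_of_pos_of_neg hgt hDb
      linarith
  have uniq : ∀ t ∈ Set.Ioc (0 : ℝ) 1, ∀ θ ∈ Set.Icc a b, ∀ η ∈ Set.Icc a b,
      (1 - 2 * t) * S θ + γ * t * D θ = 0 → (1 - 2 * t) * S η + γ * t * D η = 0 → θ = η := by
    intro t ht θ hθ η hη h1 h2
    have m1 := mem t ht θ hθ h1
    have m2 := mem t ht η hη h2
    refine anti.injOn m1 m2 ?_
    have p1 := (hSpos θ m1).ne'
    have p2 := (hSpos η m2).ne'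
    have hgt : γ * t ≠ 0 := (mul_pos hγ ht.1).ne'
    rw [div_eq_div_iff p1 p2]
    refine mul_left_cancel₀ hgt ?_
    linear_combination S η * h1 - S θ * h2
  have ex : ∀ t ∈ Set.Ioc (0 : ℝ) 1, ∃ θ ∈ Set.Icc a b,
      (1 - 2 * t) * S θ + γ * t * D θ = 0 := by
    intro t ht
    have hgt : 0 < γ * t := mul_pos hγ ht.1
    have hc : ContinuousOn (fun θ => (1 - 2 * t) * S θ + γ * t * D θ) (Set.Icc a b) := by
      have := hSd.continuous
      have := hDd.continuous
      fun_prop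
    have := intermediate_value_Icc' hab.le hc
    obtain ⟨θ, hθ, h⟩ := this (show (0 : ℝ) ∈ _ from
      ⟨by simp only [hSb]; nlinarith [mul_neg_of_pos_of_neg hgt hDb],
        by simp only [hSa]; nlinarith [mul_pos hgt hDa]⟩)
    exact ⟨θ, hθ, h⟩
  -- For `t = 0` both `a` and `b` are zeros; the value `b` is the one that continues the branch
  -- smoothly. The values for other `t` outside `[0, 1]` are irrelevant.
  have ex' : ∀ t, ∃ θ, (t ∈ Set.Ioc (0 : ℝ) 1 →
      θ ∈ Set.Icc a b ∧ (1 - 2 * t) * S θ + γ * t * D θ = 0) ∧ (t = 0 → θ = b) := by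
    intro t
    by_cases ht : t ∈ Set.Ioc (0 : ℝ) 1
    · obtain ⟨θ, h⟩ := ex t ht
      exact ⟨θ, fun _ => h, fun h0 => absurd ht.1 (by simp [h0])⟩
    · exact ⟨b, fun h => absurd h ht, fun _ => rfl⟩
  choose Θ hΘ hΘ0 using ex'
  have zero : ∀ t ∈ Set.Icc (0 : ℝ) 1, (1 - 2 * t) * S (Θ t) + γ * t * D (Θ t) = 0 := by
    intro t ht
    rcases ht.1.eq_or_lt with rfl | h
    · simp [hΘ0 0 rfl, hSb]
    · exact (hΘ t ⟨h, ht.2⟩).2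
  refine ⟨Θ, hΘ0 0 rfl, ?_, fun t ht => ⟨mem t ht _ (hΘ t ht).1 (hΘ t ht).2, fun θ hθ =>
    ⟨fun h => uniq t ht θ hθ _ (hΘ t ht).1 h (hΘ t ht).2, fun h => h ▸ (hΘ t ht).2⟩⟩⟩
  intro s hs
  let G : ℝ × ℝ → ℝ := fun x => (1 - 2 * x.1) * S x.2 + γ * x.1 * D x.2
  have hG : ContDiffAt ℝ ∞ G (s, Θ s) := by
    have h1 : ContDiff ℝ ∞ G := by
      have a1 : ContDiff ℝ ∞ fun x : ℝ × ℝ => S x.2 := hS.comp contDiff_snd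
      have a2 : ContDiff ℝ ∞ fun x : ℝ × ℝ => D x.2 := hD.comp contDiff_snd
      fun_prop
    exact h1.contDiffAt
  have hn : (∞ : WithTop ℕ∞) ≠ 0 := by simp
  have hinv : (fderiv ℝ G (s, Θ s) ∘L .inr ℝ ℝ ℝ).IsInvertible := by
    have hg : HasDerivAt (fun θ => G (s, θ))
        ((1 - 2 * s) * deriv S (Θ s) + γ * s * deriv D (Θ s)) (Θ s) :=
      ((hSd (Θ s)).hasDerivAt.const_mul (1 - 2 * s)).add
        ((hDd (Θ s)).hasDerivAt.const_mul (γ * s))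
    have hf : HasFDerivAt (fun θ => G (s, θ)) (fderiv ℝ G (s, Θ s) ∘L .inr ℝ ℝ ℝ) (Θ s) :=
      (hG.differentiableAt hn).hasFDerivAt.comp (Θ s) (hasFDerivAt_prodMk_right s (Θ s))
    have e := hf.unique hg.hasFDerivAt
    rw [e]
    have hne := pencil_deriv_ne_zero hγ (hW (Θ s)) (zero s hs)
    refine ⟨ContinuousLinearEquiv.unitsEquivAut ℝ (Units.mk0 _ hne), ?_⟩
    ext
    simp
  set φ := hG.implicitFunction hn hinv with hφ
  have hφs : φ s = Θ s := hG.implicitFunction_apply_self hn hinv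
  have hφG : ∀ᶠ t in nhds s, (1 - 2 * t) * S (φ t) + γ * t * D (φ t) = 0 := by
    filter_upwards [hG.eventually_apply_implicitFunction hn hinv] with t ht
    exact ht.trans (zero s hs)
  have hφc : ContDiffAt ℝ ∞ φ s := hG.contDiffAt_implicitFunction hn hinv
  refine hφc.contDiffWithinAt.congr_of_eventuallyEq ?_ hφs.symm
  have hcont := hφc.continuousAt
  rcases hs.1.eq_or_lt with rfl | hpos
  -- At `t = 0` the implicit function starts at the end point `b` and might leave `[a, b]`. To the
  -- right of `b`, however, `S ≤ 0` and `D < 0`, so the combination is negative for small `t > 0`;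
  -- hence `φ t ≤ b` and uniqueness in `[a, b]` applies.
  · have hb : φ 0 = b := hφs.trans (hΘ0 0 rfl)
    have c1 : ∀ᶠ t in nhds (0 : ℝ), φ t ∈ Set.Ioo a (b + 1) :=
      hcont.eventually (by rw [hb]; exact Ioo_mem_nhds hab (by linarith))
    have c2 : ∀ᶠ t in nhds (0 : ℝ), D (φ t) < 0 :=
      hcont.eventually (by
        rw [hb]; exact hDd.continuous.continuousAt.eventually (gt_mem_nhds hDb))
    have c3 : ∀ᶠ t in nhds (0 : ℝ), t < 1 / 2 := gt_mem_nhds (by norm_num)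
    filter_upwards [nhdsWithin_le_nhds c1, nhdsWithin_le_nhds c2, nhdsWithin_le_nhds c3,
      nhdsWithin_le_nhds hφG, self_mem_nhdsWithin] with t h1 h2 h3 h4 h5
    rcases h5.1.eq_or_lt with rfl | ht
    · exact hφs.symm
    · have htb : φ t ≤ b := by
        by_contra! hlt
        have q1 := hSneg (φ t) ⟨hlt.le, h1.2.le⟩
        have q2 : γ * t * D (φ t) < 0 := mul_neg_of_pos_of_neg (mul_pos hγ ht) h2
        nlinarith
      exact (uniq t ⟨ht, h5.2⟩ _ ⟨h1.1.le, htb⟩ _ (hΘ t ⟨ht, h5.2⟩).1 h4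
        (hΘ t ⟨ht, h5.2⟩).2).symm
  · have m := mem s ⟨hpos, hs.2⟩ _ (hΘ s ⟨hpos, hs.2⟩).1 (hΘ s ⟨hpos, hs.2⟩).2
    have c1 : ∀ᶠ t in nhds s, φ t ∈ Set.Ioo a b :=
      hcont.eventually (by rw [hφs]; exact Ioo_mem_nhds m.1 m.2)
    filter_upwards [nhdsWithin_le_nhds c1, nhdsWithin_le_nhds (lt_mem_nhds hpos),
      nhdsWithin_le_nhds hφG, self_mem_nhdsWithin] with t h1 h2 h4 h5
    exact (uniq t ⟨h2, h5.2⟩ _ ⟨h1.1.le, h1.2.le⟩ _ (hΘ t ⟨h2, h5.2⟩).1 h4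
      (hΘ t ⟨h2, h5.2⟩).2).symm

/-! ### The equation for `u` in an angular variable -/

/-- The factor of `f` that has no zeros in `[0, 2]`. -/
def cofactor (ζ : ℝ) : ℝ := (2 + ζ) * (6 + ζ) * (8 - ζ) * (4 - ζ)

/-- The derivative of `ζ * f ζ`. -/
def slope (ζ : ℝ) : ℝ :=
  768 - 320 * ζ - 648 * ζ ^ 2 + 176 * ζ ^ 3 + 30 * ζ ^ 4 - 6 * ζ ^ 5

lemma f_eq (ζ : ℝ) : f ζ = (2 - ζ) * cofactor ζ := by unfold f cofactor; ring

lemma hasDerivAt_f (ζ : ℝ) :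
    HasDerivAt f (-160 - 432 * ζ + 132 * ζ ^ 2 + 24 * ζ ^ 3 - 5 * ζ ^ 4) ζ := by
  have e : f = fun ζ => 768 - 160 * ζ - 216 * ζ ^ 2 + 44 * ζ ^ 3 + 6 * ζ ^ 4 - ζ ^ 5 := by
    funext ζ; unfold f; ring
  rw [e]
  have hi := hasDerivAt_id' ζ
  refine ((((((hasDerivAt_const ζ (768 : ℝ)).sub (hi.const_mul 160)).sub
    ((hi.pow 2).const_mul 216)).add ((hi.pow 3).const_mul 44)).add
    ((hi.pow 4).const_mul 6)).sub (hi.pow 5)).congr_deriv ?_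
  norm_num
  ring

lemma slope_eq (ζ : ℝ) : slope ζ = f ζ + ζ * deriv f ζ := by
  rw [(hasDerivAt_f ζ).deriv]; unfold slope f; ring

lemma cofactor_pos {ζ : ℝ} (h0 : 0 ≤ ζ) (h2 : ζ ≤ 2) : 0 < cofactor ζ := by
  have h1 : 0 < 2 + ζ := by linarith
  have h2 : 0 < 6 + ζ := by linarith
  have h3 : 0 < 8 - ζ := by linarith
  have h4 : 0 < 4 - ζ := by linarith
  unfold cofactor
  positivity

lemma f_pos {ζ : ℝ} (h0 : 0 ≤ ζ) (h2 : ζ < 2) : 0 < f ζ := by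
  rw [f_eq]
  exact mul_pos (by linarith) (cofactor_pos h0 h2.le)

/-- `u √(f (u²))` for `u = √2 sin θ`. -/
def angS (θ : ℝ) : ℝ := Real.sin (2 * θ) * √(cofactor (2 * Real.sin θ ^ 2))

/-- The part of the equation multiplied by `γ t`, in the variable `θ`. It equals `√(cofactor ζ)`
times the derivative of `angS`, where `ζ = 2 sin² θ`. -/
def angD (θ : ℝ) : ℝ := slope (2 * Real.sin θ ^ 2)

lemma two_sin_sq_mem (θ : ℝ) : 0 ≤ 2 * Real.sin θ ^ 2 ∧ 2 * Real.sin θ ^ 2 ≤ 2 :=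
  ⟨by positivity, by have := Real.sin_sq_le_one θ; linarith⟩

lemma cofactor_sin_pos (θ : ℝ) : 0 < cofactor (2 * Real.sin θ ^ 2) :=
  cofactor_pos (two_sin_sq_mem θ).1 (two_sin_sq_mem θ).2

lemma contDiff_angS : ContDiff ℝ ∞ angS := by
  have h1 : ContDiff ℝ ∞ fun θ : ℝ => Real.sin (2 * θ) :=
    Real.contDiff_sin.comp (contDiff_const.mul contDiff_id)
  have h2 : ContDiff ℝ ∞ fun θ : ℝ => cofactor (2 * Real.sin θ ^ 2) := by
    have := Real.contDiff_sin (n := ∞)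
    unfold cofactor
    fun_prop
  exact h1.mul (h2.sqrt fun θ => (cofactor_sin_pos θ).ne')

lemma contDiff_angD : ContDiff ℝ ∞ angD := by
  have := Real.contDiff_sin (n := ∞)
  unfold angD slope
  fun_prop

/-- `ζ * f ζ` is strictly concave after taking the square root. -/
lemma concavity {ζ : ℝ} (h0 : 0 ≤ ζ) (h2 : ζ ≤ 2) :
    2 * (ζ * f ζ) * (-320 - 1296 * ζ + 528 * ζ ^ 2 + 120 * ζ ^ 3 - 30 * ζ ^ 4) < slope ζ ^ 2 := by
  -- The polynomial `ζ * f ζ` is invariant under `ζ ↦ 2 - ζ`, so the difference of the two sides is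
  -- a polynomial in `(ζ - 1) ^ 2`, which lies in `[0, 1]`.
  obtain ⟨m, hm⟩ : ∃ m, m = (ζ - 1) ^ 2 := ⟨_, rfl⟩
  have m0 : 0 ≤ m := hm ▸ sq_nonneg _
  have m1 : m ≤ 1 := by rw [hm]; nlinarith
  have key : slope ζ ^ 2
      - 2 * (ζ * f ζ) * (-320 - 1296 * ζ + 528 * ζ ^ 2 + 120 * ζ ^ 3 - 30 * ζ ^ 4)
      = 880236 - 624456 * m + 379752 * m ^ 2 - 47808 * m ^ 3 + 2124 * m ^ 4 - 24 * m ^ 5 := by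
    rw [hm]; unfold slope f; ring
  have e3 : m ^ 3 ≤ 1 := pow_le_one₀ m0 m1
  have e5 : m ^ 5 ≤ 1 := pow_le_one₀ m0 m1
  have e2 := sq_nonneg m
  have e4 : 0 ≤ m ^ 4 := by positivity
  linarith

/-- With `g ζ = ζ f ζ` and `r = √(cofactor ζ)`, the Wronskian is `(2 g g'' - g' ^ 2) / r`, which
`concavity` shows to be negative. -/
lemma wronskian_neg (θ : ℝ) : angS θ * deriv angD θ - deriv angS θ * angD θ < 0 := by
  obtain ⟨ζ, hζ⟩ : ∃ ζ, ζ = 2 * Real.sin θ ^ 2 := ⟨_, rfl⟩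
  have h0 : 0 ≤ ζ := hζ ▸ (two_sin_sq_mem θ).1
  have h2 : ζ ≤ 2 := hζ ▸ (two_sin_sq_mem θ).2
  have kpos := cofactor_pos h0 h2
  have hsin : HasDerivAt (fun θ => 2 * Real.sin θ ^ 2) (2 * Real.sin (2 * θ)) θ := by
    refine (((Real.hasDerivAt_sin θ).pow 2).const_mul 2).congr_deriv ?_
    rw [Real.sin_two_mul]; norm_num
  have hsin2 : HasDerivAt (fun θ : ℝ => Real.sin (2 * θ)) (2 * Real.cos (2 * θ)) θ := by
    have h : HasDerivAt (fun θ : ℝ => 2 * θ) 2 θ := by simpa using (hasDerivAt_id' θ).const_mul 2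
    exact h.sin.congr_deriv (by ring)
  have hk : HasDerivAt cofactor (112 - 104 * ζ - 12 * ζ ^ 2 + 4 * ζ ^ 3) ζ := by
    have e : cofactor = fun ζ => 384 + 112 * ζ - 52 * ζ ^ 2 - 4 * ζ ^ 3 + ζ ^ 4 := by
      funext ζ; unfold cofactor; ring
    rw [e]
    have hi := hasDerivAt_id' ζ
    refine (((((hasDerivAt_const ζ (384 : ℝ)).add (hi.const_mul 112)).sub
      ((hi.pow 2).const_mul 52)).sub ((hi.pow 3).const_mul 4)).add (hi.pow 4)).congr_deriv ?_
    norm_num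
    ring
  have hs : HasDerivAt slope (-320 - 1296 * ζ + 528 * ζ ^ 2 + 120 * ζ ^ 3 - 30 * ζ ^ 4) ζ := by
    have hi := hasDerivAt_id' ζ
    refine ((((((hasDerivAt_const ζ (768 : ℝ)).sub (hi.const_mul 320)).sub
      ((hi.pow 2).const_mul 648)).add ((hi.pow 3).const_mul 176)).add
      ((hi.pow 4).const_mul 30)).sub ((hi.pow 5).const_mul 6)).congr_deriv ?_
    norm_num
    ring
  rw [hζ] at hk hs
  have dD := (hs.comp θ hsin).deriv
  have hkθ : (cofactor ∘ fun θ => 2 * Real.sin θ ^ 2) θ ≠ 0 := (cofactor_sin_pos θ).ne'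
  have dS := (hsin2.mul ((hk.comp θ hsin).sqrt hkθ)).deriv
  have eD : deriv angD θ = _ := dD
  have eS : deriv angS θ = _ := dS
  rw [eD, eS]
  simp only [angS, angD, Function.comp_apply, ← hζ]
  obtain ⟨r, hr⟩ : ∃ r, r = √(cofactor ζ) := ⟨_, rfl⟩
  have rpos : 0 < r := hr ▸ Real.sqrt_pos.2 kpos
  have rsq : r ^ 2 = cofactor ζ := hr ▸ Real.sq_sqrt kpos.le
  rw [← hr]
  have hc : Real.cos (2 * θ) = 1 - ζ := by
    rw [hζ, Real.cos_two_mul, Real.cos_sq']; ring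
  have hss : Real.sin (2 * θ) ^ 2 = ζ * (2 - ζ) := by
    rw [Real.sin_sq, hc]; ring
  rw [hc]
  obtain ⟨s, hs'⟩ : ∃ s, s = Real.sin (2 * θ) := ⟨_, rfl⟩
  rw [← hs'] at hss ⊢
  have key := concavity h0 h2
  refine neg_of_mul_neg_left (b := r) ?_ rpos.le
  refine lt_of_eq_of_lt ?_ (sub_neg.2 key)
  have r0 := rpos.ne'
  field_simp
  rw [rsq, hss, f_eq]
  unfold cofactor slope
  ring

/-- Since `2 - u² = 2 cos² θ`, the factor `√(2 - u²)` is `√2 cos θ`; the sign of the cosine is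
needed for this. Together with `u` it gives the smooth function `sin (2θ)`. -/
lemma eqU_sin {γ t θ : ℝ} (hθ : 0 ≤ Real.cos θ) :
    eqU γ t (√2 * Real.sin θ) ↔ (1 - 2 * t) * angS θ + γ * t * angD θ = 0 := by
  have hsq : (√2 * Real.sin θ) ^ 2 = 2 * Real.sin θ ^ 2 := by rw [mul_pow]; norm_num
  have hf : √2 * Real.sin θ * √(f (2 * Real.sin θ ^ 2)) = angS θ := by
    have e : 2 - 2 * Real.sin θ ^ 2 = 2 * Real.cos θ ^ 2 := by rw [Real.cos_sq']; ring
    rw [f_eq, e, Real.sqrt_mul (by positivity), Real.sqrt_mul (by norm_num), Real.sqrt_sq hθ,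
      angS, Real.sin_two_mul]
    have h2 : √2 * √2 = (2 : ℝ) := by norm_num
    linear_combination (Real.sin θ * Real.cos θ * √(cofactor (2 * Real.sin θ ^ 2))) * h2
  have e : (1 - 2 * t) * (√2 * Real.sin θ) * √(f ((√2 * Real.sin θ) ^ 2))
        + γ * t * f ((√2 * Real.sin θ) ^ 2)
        + γ * t * (√2 * Real.sin θ) ^ 2 * deriv f ((√2 * Real.sin θ) ^ 2)
      = (1 - 2 * t) * angS θ + γ * t * angD θ := by
    rw [hsq, angD, slope_eq, ← hf]; ring
  rw [eqU, e]

lemma eqV_iff (γ t v : ℝ) : eqV γ t v ↔ eqU γ t (-v) := by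
  rw [eqV, eqU, neg_sq, mul_neg, ← neg_mul]

lemma eqU_zero_iff {γ u : ℝ} (hu : u ∈ I₂) : eqU γ 0 u ↔ u = 0 ∨ u = √2 ∨ u = -√2 := by
  have e : eqU γ 0 u ↔ u * √(f (u ^ 2)) = 0 := by simp [eqU]
  have h2 : u ^ 2 ≤ 2 := sq_le_two ⟨u, hu⟩
  have hs : √2 ^ 2 = (2 : ℝ) := by norm_num
  rw [e, mul_eq_zero]
  refine or_congr_right ⟨fun h => ?_, fun h => ?_⟩
  · have hn : ¬u ^ 2 < 2 := fun hlt => (Real.sqrt_pos.2 (f_pos (sq_nonneg u) hlt)).ne' h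
    exact sq_eq_sq_iff_eq_or_eq_neg.1 (by linarith)
  · have : u ^ 2 = 2 := by rcases h with rfl | rfl <;> simp
    rw [this]
    simp [f]

/-- The smooth branches of solutions. -/
theorem exists_branches {γ : ℝ} (hγ : 0 < γ) :
    ∃ m p : ℝ → ℝ, m 0 = 0 ∧ p 0 = √2 ∧
      ContDiffOn ℝ ∞ m (Set.Icc 0 1) ∧ ContDiffOn ℝ ∞ p (Set.Icc 0 1) ∧
      ∀ t ∈ Set.Ioc (0 : ℝ) 1, m t ∈ Set.Ioo (-√2) 0 ∧ p t ∈ Set.Ioo 0 √2 ∧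
        ∀ u ∈ I₂, eqU γ t u ↔ u = m t ∨ u = p t := by
  have hpi := Real.pi_pos
  have hpi3 := Real.pi_gt_three
  have s2 : (0 : ℝ) < √2 := by positivity
  obtain ⟨P, P0, Ps, hP⟩ := exists_smooth_zero (S := angS) (D := angD) (a := 0) (b := Real.pi / 2)
    hγ (by linarith) contDiff_angS contDiff_angD wronskian_neg (by simp [angS])
    (by simp [angS, mul_div_cancel₀])
    (fun θ hθ => mul_pos (Real.sin_pos_of_pos_of_lt_pi (by linarith [hθ.1]) (by linarith [hθ.2]))
      (Real.sqrt_pos.2 (cofactor_sin_pos θ)))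
    (fun θ hθ => by
      refine mul_nonpos_of_nonpos_of_nonneg ?_ (Real.sqrt_nonneg _)
      have := Real.sin_nonneg_of_nonneg_of_le_pi (x := 2 * θ - Real.pi) (by linarith [hθ.1])
        (by linarith [hθ.2])
      rw [Real.sin_sub_pi] at this
      linarith)
    (by norm_num [angD, slope]) (by norm_num [angD, slope])
  -- On the left half `angS` is negative. Changing the signs of both functions preserves the zeros
  -- and the Wronskian and restores the required positivity.
  obtain ⟨Q, Q0, Qs, hQ⟩ := exists_smooth_zero (S := fun θ => -angS θ) (D := fun θ => -angD θ)
    (a := -(Real.pi / 2)) (b := 0)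
    hγ (by linarith) contDiff_angS.neg contDiff_angD.neg
    (fun θ => by
      have := wronskian_neg θ
      simp only [deriv.fun_neg]
      linarith)
    (by simp [angS, mul_div_cancel₀]) (by simp [angS])
    (fun θ hθ => by
      have := Real.sin_pos_of_pos_of_lt_pi (x := -(2 * θ)) (by linarith [hθ.2])
        (by linarith [hθ.1])
      rw [Real.sin_neg] at this
      have := mul_pos this (Real.sqrt_pos.2 (cofactor_sin_pos θ))
      simp only [angS]
      linarith)
    (fun θ hθ => by
      have := mul_nonneg (Real.sin_nonneg_of_nonneg_of_le_pi (x := 2 * θ) (by linarith [hθ.1])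
        (by linarith [hθ.2])) (Real.sqrt_nonneg (cofactor (2 * Real.sin θ ^ 2)))
      simp only [angS]
      linarith)
    (by norm_num [angD, slope]) (by norm_num [angD, slope])
  have hsm : ContDiff ℝ ∞ fun θ => √2 * Real.sin θ := contDiff_const.mul Real.contDiff_sin
  refine ⟨fun t => √2 * Real.sin (Q t), fun t => √2 * Real.sin (P t), by simp [Q0], by simp [P0],
    hsm.comp_contDiffOn Qs, hsm.comp_contDiffOn Ps, fun t ht => ?_⟩
  obtain ⟨⟨P1, P2⟩, hP⟩ := hP t ht
  obtain ⟨⟨Q1, Q2⟩, hQ⟩ := hQ t ht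
  have sP : 0 < Real.sin (P t) := Real.sin_pos_of_pos_of_lt_pi P1 (by linarith)
  have sQ : Real.sin (Q t) < 0 := Real.sin_neg_of_neg_of_neg_pi_lt Q2 (by linarith)
  have lP : Real.sin (P t) < 1 := by
    have := Real.sin_lt_sin_of_lt_of_le_pi_div_two (by linarith) le_rfl P2
    simpa using this
  have lQ : -1 < Real.sin (Q t) := by
    have := Real.sin_lt_sin_of_lt_of_le_pi_div_two le_rfl (by linarith) Q1
    simpa using this
  have half : ∀ θ ∈ Set.Icc (-(Real.pi / 2)) (Real.pi / 2),
      (eqU γ t (√2 * Real.sin θ) ↔ θ = Q t ∨ θ = P t) := by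
    intro θ hθ
    rw [eqU_sin (Real.cos_nonneg_of_mem_Icc hθ)]
    constructor
    · intro h
      rcases le_total θ 0 with h0 | h0
      · exact .inl ((hQ θ ⟨hθ.1, h0⟩).1 (by linear_combination -h))
      · exact .inr ((hP θ ⟨h0, hθ.2⟩).1 h)
    · rintro (rfl | rfl)
      · linear_combination -(hQ _ ⟨hθ.1, Q2.le⟩).2 rfl
      · exact (hP _ ⟨P1.le, hθ.2⟩).2 rfl
  refine ⟨⟨by nlinarith, by nlinarith⟩, ⟨by nlinarith, by nlinarith⟩, fun u hu => ?_⟩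
  have b1 : -1 ≤ u / √2 := by rw [le_div_iff₀ s2]; linarith [hu.1]
  have b2 : u / √2 ≤ 1 := by rw [div_le_iff₀ s2]; linarith [hu.2]
  have eu : u = √2 * Real.sin (Real.arcsin (u / √2)) := by
    rw [Real.sin_arcsin b1 b2]; field_simp
  obtain ⟨θ, hθ⟩ : ∃ θ, θ = Real.arcsin (u / √2) := ⟨_, rfl⟩
  have mθ : θ ∈ Set.Icc (-(Real.pi / 2)) (Real.pi / 2) := hθ ▸ Real.arcsin_mem_Icc _
  rw [← hθ] at eu
  rw [eu, half θ mθ, mul_right_inj' s2.ne', mul_right_inj' s2.ne',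
    Real.injOn_sin.eq_iff mθ ⟨Q1.le, by linarith⟩, Real.injOn_sin.eq_iff mθ ⟨by linarith, P2.le⟩]

/-! ### Fixed points in charts -/

/-- The chain rule with the chart and with its inverse, both smooth; neither direction presupposes
differentiability of `F`. -/
theorem isFixedPoint_iff {F : M → ℝ × ℝ} {p : M} {ν : Fin 8} (hp : p ∈ U ν) :
    IsFixedPoint F p ↔
      HasFDerivAt (F ∘ chartInv ν) (0 : ℂ × ℂ →L[ℝ] ℝ × ℝ) (chartFun ν p) := by
  have hat : chart ν ∈ IsManifold.maximalAtlas 𝓘(ℝ, ℂ × ℂ) ∞ M :=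
    IsManifold.subset_maximalAtlas ⟨ν, rfl⟩
  have hinv : chartInv ν (chartFun ν p) = p := (chart ν).left_inv hp
  have hn : (∞ : WithTop ℕ∞) ≠ 0 := by simp
  constructor
  · intro h
    have hs : MDifferentiableAt 𝓘(ℝ, ℂ × ℂ) 𝓘(ℝ, ℂ × ℂ) (chartInv ν) (chartFun ν p) :=
      (contMDiffAt_symm_of_mem_maximalAtlas hat ((chart ν).map_source hp)).mdifferentiableAt hn
    have h' : HasMFDerivAt 𝓘(ℝ, ℂ × ℂ) 𝓘(ℝ, ℝ × ℝ) F (chartInv ν (chartFun ν p)) 0 := by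
      rw [hinv]; exact h
    have := h'.comp (chartFun ν p) hs.hasMFDerivAt
    rw [ContinuousLinearMap.zero_comp] at this
    exact hasMFDerivAt_iff_hasFDerivAt.1 this
  · intro h
    have hc : MDifferentiableAt 𝓘(ℝ, ℂ × ℂ) 𝓘(ℝ, ℂ × ℂ) (chartFun ν) p :=
      (contMDiffAt_of_mem_maximalAtlas hat hp).mdifferentiableAt hn
    have := (hasMFDerivAt_iff_hasFDerivAt.2 h).comp p hc.hasMFDerivAt
    have := this.congr_mfderiv (ContinuousLinearMap.zero_comp _)
    refine this.congr_of_eventuallyEq ?_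
    filter_upwards [(isOpen_U ν).mem_nhds hp] with q hq
    exact congrArg F ((chart ν).left_inv hq).symm

/-! ### The family `F_t` in chart coordinates -/

lemma chartFun_injOn (ν : Fin 8) : Set.InjOn (chartFun ν) (U ν) := (chart ν).injOn

/-- `F_t` as a function on `ℂ⁸`. -/
def ambient (γ t : ℝ) (z : Fin 8 → ℂ) : ℝ × ℝ :=
  (‖z 0‖ ^ 2 / 2, (1 - 2 * t) * (‖z 2‖ ^ 2 / 2) +
    t * γ * (star (z 1) * star (z 2) * star (z 3) * z 5 * z 6 * z 7).re)

lemma Ft_mk (γ t : ℝ) (z : levelSet) : Ft γ t (M.mk z) = ambient γ t z.1 := rfl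

lemma Ft_chartInv (γ t : ℝ) {ν : Fin 8} {w : ℂ × ℂ} (hw : w ∈ V ν) :
    Ft γ t (chartInv ν w) = ambient γ t (slice ν w) := by
  rw [chartInv_of_mem hw, Ft_mk]

lemma contDiff_ambient (γ t : ℝ) : ContDiff ℝ ∞ (ambient γ t) := by
  have hk : ∀ k, ContDiff ℝ ∞ (fun z : Fin 8 → ℂ => z k) := contDiff_apply ℝ ℂ
  have hs : ∀ k, ContDiff ℝ ∞ (fun z : Fin 8 → ℂ => star (z k)) := fun k =>
    Complex.conjCLE.contDiff.comp (hk k)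
  have hn : ∀ k, ContDiff ℝ ∞ (fun z : Fin 8 → ℂ => ‖z k‖ ^ 2) := fun k => (hk k).norm_sq ℝ
  have hm : ContDiff ℝ ∞ (fun z : Fin 8 → ℂ =>
      (star (z 1) * star (z 2) * star (z 3) * z 5 * z 6 * z 7).re) :=
    Complex.reCLM.contDiff.comp
      ((((((hs 1).mul (hs 2)).mul (hs 3)).mul (hk 5)).mul (hk 6)).mul (hk 7))
  exact ((hn 0).div_const 2).prodMk
    ((contDiff_const.mul ((hn 2).div_const 2)).add (contDiff_const.mul hm))

/-- `F_t` in the chart on `U ν`. -/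
def inChart (γ t : ℝ) (ν : Fin 8) (w : ℂ × ℂ) : ℝ × ℝ := ambient γ t (slice ν w)

lemma chartFun_mem {ν : Fin 8} {p : M} (hp : p ∈ U ν) : chartFun ν p ∈ V ν :=
  (chart ν).map_source hp

theorem isFixedPoint_Ft_iff {γ t : ℝ} {p : M} {ν : Fin 8} (hp : p ∈ U ν) :
    IsFixedPoint (Ft γ t) p ↔
      HasFDerivAt (inChart γ t ν) (0 : ℂ × ℂ →L[ℝ] ℝ × ℝ) (chartFun ν p) := by
  rw [isFixedPoint_iff hp]
  refine Filter.EventuallyEq.hasFDerivAt_iff ?_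
  filter_upwards [(isOpen_V ν).mem_nhds (chartFun_mem hp)] with w hw
  exact Ft_chartInv γ t hw

lemma differentiableAt_local (γ t : ℝ) {ν : Fin 8} {w : ℂ × ℂ} (hw : w ∈ V ν) :
    DifferentiableAt ℝ (inChart γ t ν) w := by
  have h1 : ContDiffAt ℝ ∞ (slice ν) w := contDiffAt_pi.2 fun k =>
    (contDiffOn_slice ν k).contDiffAt ((isOpen_V ν).mem_nhds hw)
  exact ((contDiff_ambient γ t).contDiffAt.comp w h1).differentiableAt (by simp)

/-- Differentiate `G ∘ a = G` at the fixed point `w` of `a`. Applied to sign changes, this kills the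
derivative in the reflected directions. -/
lemma fderiv_comp_of_invariant {E F : Type*} [NormedAddCommGroup E] [NormedSpace ℝ E]
    [NormedAddCommGroup F] [NormedSpace ℝ F] {G : E → F} {L : E →L[ℝ] F} {w : E}
    (hG : HasFDerivAt G L w) (a : E →L[ℝ] E) (haw : a w = w) (hGa : ∀ x, G (a x) = G x) :
    L ∘L a = L := by
  have h1 : HasFDerivAt G L (a w) := haw.symm ▸ hG
  have h2 : HasFDerivAt (fun x => G (a x)) (L ∘L a) w := h1.comp w a.hasFDerivAt
  rw [funext hGa] at h2
  exact h2.unique hG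

lemma sqModulus_congr {ν k : Fin 8} {w w' : ℂ × ℂ} (h1 : ‖w.1‖ = ‖w'.1‖) (h2 : ‖w.2‖ = ‖w'.2‖) :
    sqModulus ν w k = sqModulus ν w' k := by
  simp only [sqModulus, h1, h2]

/-- The critical points of `J`. -/
lemma coordinates_of_isFixedPoint {γ t : ℝ} {z : levelSet} {ν : Fin 8} (hp : M.mk z ∈ U ν)
    (h : IsFixedPoint (Ft γ t) (M.mk z)) :
    (expo₁ ν 0 = 0 ∨ z.1 ν = 0) ∧ (expo₂ ν 0 = 0 ∨ z.1 (ν + 1) = 0) := by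
  have hz := mk_mem_U.1 hp
  obtain ⟨w, hw⟩ : ∃ w, w = chartFun ν (M.mk z) := ⟨_, rfl⟩
  have hw1 : ‖w.1‖ = ‖z.1 ν‖ := by
    rw [hw]; change ‖(chartMap ν z.1).1‖ = _
    rw [chartMap, norm_mul, norm_prod_phase hz, mul_one]
  have hw2 : ‖w.2‖ = ‖z.1 (ν + 1)‖ := by
    rw [hw]; change ‖(chartMap ν z.1).2‖ = _
    rw [chartMap, norm_mul, norm_prod_phase hz, mul_one]
  rw [isFixedPoint_Ft_iff hp, ← hw] at h
  have hwV : w ∈ V ν := hw ▸ chartFun_mem hp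
  have hJ : HasFDerivAt (fun w => sqModulus ν w 0 / 2) (0 : ℂ × ℂ →L[ℝ] ℝ) w := by
    have := (ContinuousLinearMap.fst ℝ ℝ ℝ).hasFDerivAt.comp w h
    rw [ContinuousLinearMap.comp_zero] at this
    refine this.congr_of_eventuallyEq ?_
    filter_upwards [(isOpen_V ν).mem_nhds hwV] with x hx
    have := norm_sq_eq (slice_mem hx) ν 0
    rw [slice_fst, slice_snd] at this
    change _ = ‖slice ν x 0‖ ^ 2 / 2
    rw [this]
  have hd : HasFDerivAt (fun w : ℂ × ℂ => sqModulus ν w 0 / 2) _ w :=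
    ((((hasFDerivAt_fst (𝕜 := ℝ) (p := w)).norm_sq.sub_const (2 * offset ν)).const_mul
      (expo₁ ν 0 : ℝ)).const_add (2 * offset 0)).add
      (((hasFDerivAt_snd (𝕜 := ℝ) (p := w)).norm_sq.sub_const (2 * offset (ν + 1))).const_mul
      (expo₂ ν 0 : ℝ)) |>.mul_const (2 : ℝ)⁻¹
  have e := hd.unique hJ
  -- Evaluated in the radial directions, the differential of `J` is the exponent times the squared
  -- modulus of the coordinate.
  have e1 := DFunLike.congr_fun e (w.1, 0)
  have e2 := DFunLike.congr_fun e (0, w.2)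
  simp at e1 e2
  rw [← norm_eq_zero (a := z.1 ν), ← norm_eq_zero (a := z.1 (ν + 1)), ← hw1, ← hw2]
  simpa using And.intro e1 e2

/-- For these `ν` both chart coordinates are factors of `Z`, so changing both signs preserves `F_t`,
and an even function has zero derivative at the origin. -/
lemma isFixedPoint_of_vertex {ν : Fin 8} (hν : ν = 1 ∨ ν = 2 ∨ ν = 5 ∨ ν = 6) (γ t : ℝ) {p : M}
    (hp : p ∈ U ν) (h0 : chartFun ν p = 0) : IsFixedPoint (Ft γ t) p := by
  rw [isFixedPoint_Ft_iff hp]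
  have hd := (differentiableAt_local γ t (chartFun_mem hp)).hasFDerivAt
  have hev : ∀ w, inChart γ t ν (-w) = inChart γ t ν w := fun w => by
    have hs : ∀ k, sqModulus ν (-w) k = sqModulus ν w k := fun k =>
      sqModulus_congr (norm_neg _) (norm_neg _)
    rcases hν with rfl | rfl | rfl | rfl <;> simp [inChart, ambient, slice, hs]
  have := fderiv_comp_of_invariant hd (-(ContinuousLinearMap.id ℝ (ℂ × ℂ))) (by simp [h0])
    (fun w => by simpa using hev w)
  have h' : fderiv ℝ (inChart γ t ν) (chartFun ν p) = 0 := by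
    refine ContinuousLinearMap.ext fun x => ?_
    have hx := DFunLike.congr_fun this x
    rw [ContinuousLinearMap.comp_apply, neg_apply, map_neg] at hx
    exact self_eq_neg.1 hx.symm
  rw [h'] at hd
  exact hd

/-- The restriction of `H_t` to the spheres `J = 0` and `J = 3`. -/
def profile (c d : ℝ) (w : ℂ) : ℝ := c * (‖w‖ ^ 2 / 2) + d * (w.re * √(f (‖w‖ ^ 2)))

/-- With `w = x + iy` and `r = √(f(|w|²))`, the partial derivatives are `c x + d r + d x² f' / r`
and `y (c + d x f' / r)`. The first, multiplied by `r`, is the equation. -/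
lemma hasFDerivAt_profile_iff {c d : ℝ} (hcd : d = 0 → c ≠ 0) {w : ℂ} (hw : ‖w‖ ^ 2 < 2) :
    HasFDerivAt (profile c d) (0 : ℂ →L[ℝ] ℝ) w ↔
      w.im = 0 ∧ c * w.re * √(f (w.re ^ 2)) + d * f (w.re ^ 2)
        + d * w.re ^ 2 * deriv f (w.re ^ 2) = 0 := by
  have hq : ∀ w : ℂ, ‖w‖ ^ 2 = w.re ^ 2 + w.im ^ 2 := fun w => by
    rw [← Complex.normSq_eq_norm_sq, Complex.normSq_apply]; ring
  have fpos := f_pos (sq_nonneg ‖w‖) hw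
  obtain ⟨r, hr⟩ : ∃ r, r = √(f (‖w‖ ^ 2)) := ⟨_, rfl⟩
  have rpos : 0 < r := hr ▸ Real.sqrt_pos.2 fpos
  have rsq : r ^ 2 = f (‖w‖ ^ 2) := hr ▸ Real.sq_sqrt fpos.le
  obtain ⟨f', hf'⟩ : ∃ f', f' = deriv f (‖w‖ ^ 2) := ⟨_, rfl⟩
  have hre := Complex.reCLM.hasFDerivAt (x := w)
  have hn : HasFDerivAt (fun w : ℂ => ‖w‖ ^ 2)
      ((2 * w.re) • Complex.reCLM + (2 * w.im) • Complex.imCLM) w := by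
    rw [funext hq]
    have := (hre.pow 2).add ((Complex.imCLM.hasFDerivAt (x := w)).pow 2)
    refine this.congr_fderiv ?_
    ext
    all_goals simp
  have hfd : HasDerivAt f f' (‖w‖ ^ 2) :=
    hf' ▸ (hasDerivAt_f _).differentiableAt.hasDerivAt
  have hne : (f ∘ fun w : ℂ => ‖w‖ ^ 2) w ≠ 0 := fpos.ne'
  have hs : HasFDerivAt (fun w : ℂ => √(f (‖w‖ ^ 2))) _ w :=
    (hfd.comp_hasFDerivAt w hn).sqrt hne
  have hd : HasFDerivAt (profile c d) _ w :=
    ((hn.mul_const (2 : ℝ)⁻¹).const_mul c).add ((hre.mul hs).const_mul d)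
  have key : HasFDerivAt (profile c d)
      ((c * w.re + d * r + d * w.re ^ 2 * f' / r) • Complex.reCLM
        + (w.im * (c + d * w.re * f' / r)) • Complex.imCLM) w := by
    refine hd.congr_fderiv ?_
    ext
    all_goals simp [← hr]; field_simp; ring
  have : HasFDerivAt (profile c d) (0 : ℂ →L[ℝ] ℝ) w ↔
      c * w.re + d * r + d * w.re ^ 2 * f' / r = 0 ∧ w.im * (c + d * w.re * f' / r) = 0 := by
    constructor
    · intro h
      have e := key.unique h
      have e1 := DFunLike.congr_fun e 1
      have e2 := DFunLike.congr_fun e Complex.I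
      simp at e1 e2
      exact ⟨e1, by simpa using e2⟩
    · rintro ⟨h1, h2⟩
      rw [h1, h2] at key
      simpa using key
  rw [this]
  -- If `y ≠ 0`, then `c + d x f' / r = 0`; subtracting `x` times this from the first equation
  -- leaves `d r = 0`, so `d = 0` and then `c = 0`.
  have him : c * w.re + d * r + d * w.re ^ 2 * f' / r = 0 → w.im * (c + d * w.re * f' / r) = 0 →
      w.im = 0 := by
    intro h1 h2
    rcases mul_eq_zero.1 h2 with h | h
    · exact h
    · exfalso
      have h3 : d * r = 0 := by linear_combination h1 - w.re * h
      have h4 : d = 0 := (mul_eq_zero.1 h3).resolve_right rpos.ne'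
      rw [h4] at h
      exact hcd h4 (by simpa using h)
  have hmul : (c * w.re + d * r + d * w.re ^ 2 * f' / r) * r
      = c * w.re * r + d * r ^ 2 + d * w.re ^ 2 * f' := by field_simp
  have hfin : w.im = 0 → (c * w.re * √(f (w.re ^ 2)) + d * f (w.re ^ 2)
        + d * w.re ^ 2 * deriv f (w.re ^ 2)
      = (c * w.re + d * r + d * w.re ^ 2 * f' / r) * r) := by
    intro h0
    have hq' : ‖w‖ ^ 2 = w.re ^ 2 := by rw [hq, h0]; ring
    rw [hmul, rsq, hf', hr, hq']
  constructor
  · rintro ⟨h1, h2⟩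
    have h0 := him h1 h2
    exact ⟨h0, by rw [hfin h0, h1, zero_mul]⟩
  · rintro ⟨h0, h1⟩
    rw [hfin h0] at h1
    exact ⟨(mul_eq_zero.1 h1).resolve_right rpos.ne', by rw [h0, zero_mul]⟩

/-- Evenness in the first variable makes the derivative vanish in the direction normal to the
sphere, so only the restriction to the sphere has to be tested. There the first component is
constant. -/
theorem hasFDerivAt_zero_iff_profile {G : ℂ × ℂ → ℝ × ℝ} {j e c d : ℝ} (hcd : d = 0 → c ≠ 0)
    {w : ℂ} (hw : ‖w‖ ^ 2 < 2) (hG : DifferentiableAt ℝ G (0, w))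
    (heven : ∀ x y, G (-x, y) = G (x, y))
    (hprof : ∀ y : ℂ, ‖y‖ ^ 2 < 2 → G (0, y) = (j, e + profile c d y)) :
    HasFDerivAt G (0 : ℂ × ℂ →L[ℝ] ℝ × ℝ) (0, w) ↔
      w.im = 0 ∧ c * w.re * √(f (w.re ^ 2)) + d * f (w.re ^ 2)
        + d * w.re ^ 2 * deriv f (w.re ^ 2) = 0 := by
  rw [← hasFDerivAt_profile_iff hcd hw]
  have hev : (fun y => G (0, y)) =ᶠ[nhds w] fun y => (j, e + profile c d y) := by
    have : ∀ᶠ y : ℂ in nhds w, ‖y‖ ^ 2 < 2 :=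
      (continuous_norm.pow 2).continuousAt.eventually (gt_mem_nhds hw)
    filter_upwards [this] with y hy using hprof y hy
  constructor
  · intro h
    have h1 : HasFDerivAt (fun y => G (0, y)) _ w := h.comp w (hasFDerivAt_prodMk_right (0 : ℂ) w)
    have h2 := ((h1.congr_of_eventuallyEq hev.symm).snd).sub_const e
    simpa using h2
  · intro h
    obtain ⟨L, hL⟩ := hG
    have hinv := fderiv_comp_of_invariant hL
      ((-(ContinuousLinearMap.id ℝ ℂ)).prodMap (ContinuousLinearMap.id ℝ ℂ)) (by simp)
      (fun x => heven x.1 x.2)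
    have h1 : HasFDerivAt (fun y => G (0, y)) _ w := hL.comp w (hasFDerivAt_prodMk_right (0 : ℂ) w)
    have h2 : HasFDerivAt (fun y => G (0, y)) (0 : ℂ →L[ℝ] ℝ × ℝ) w := by
      refine HasFDerivAt.congr_of_eventuallyEq ?_ hev
      exact ((hasFDerivAt_const j w).prodMk (h.const_add e)).congr_fderiv (by ext <;> simp)
    have h3 := h1.unique h2
    have : L = 0 := by
      refine ContinuousLinearMap.ext fun x => ?_
      have hx : L (-x.1, x.2) = L x := DFunLike.congr_fun hinv x
      have h5 : ∀ y, L (0, y) = 0 := fun y => by simpa using DFunLike.congr_fun h3 y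
      -- Averaging `x` with its reflection leaves a vector tangent to the sphere, on which `L` is
      -- zero.
      have e : (2 : ℝ) • L x = L (-x.1, x.2) + L x := by rw [hx, two_smul]
      have e' : ((-x.1, x.2) : ℂ × ℂ) + x = (0, (2 : ℝ) • x.2) := by
        refine Prod.ext (neg_add_cancel x.1) (two_smul ℝ x.2).symm
      rw [← map_add, e', h5] at e
      simpa using e
    rwa [this] at hL

/-! ### The spheres `J = 0` and `J = 3` -/

/-- On the two spheres, the five factors of `f` are the squared moduli of the five coordinates that
accompany `w` in `Z`. -/
lemma sqrt_f {η : ℝ} (h0 : 0 ≤ η) (h2 : η ≤ 2) :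
    √(f η) = √(2 + η) * √(6 + η) * √(8 - η) * √(4 - η) * √(2 - η) := by
  rw [f, Real.sqrt_mul, Real.sqrt_mul, Real.sqrt_mul, Real.sqrt_mul]
  · linarith
  · exact mul_nonneg (by linarith) (by linarith)
  · exact mul_nonneg (mul_nonneg (by linarith) (by linarith)) (by linarith)
  · exact mul_nonneg (mul_nonneg (mul_nonneg (by linarith) (by linarith)) (by linarith))
      (by linarith)

lemma sqModulus_zero (y : ℂ) :
    sqModulus 0 (0, y) 2 = 2 + ‖y‖ ^ 2 ∧ sqModulus 0 (0, y) 3 = 6 + ‖y‖ ^ 2 ∧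
    sqModulus 0 (0, y) 5 = 8 - ‖y‖ ^ 2 ∧ sqModulus 0 (0, y) 6 = 4 - ‖y‖ ^ 2 ∧
    sqModulus 0 (0, y) 7 = 2 - ‖y‖ ^ 2 := by
  simp [sqModulus, offset, expo₁, expo₂, cross, normal]
  refine ⟨?_, ?_, ?_, ?_, ?_⟩ <;> ring

lemma sqModulus_four (y : ℂ) :
    sqModulus 4 (0, y) 0 = 6 ∧ sqModulus 4 (0, y) 1 = 8 - ‖y‖ ^ 2 ∧
    sqModulus 4 (0, y) 2 = 4 - ‖y‖ ^ 2 ∧ sqModulus 4 (0, y) 3 = 2 - ‖y‖ ^ 2 ∧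
    sqModulus 4 (0, y) 6 = 2 + ‖y‖ ^ 2 ∧ sqModulus 4 (0, y) 7 = 6 + ‖y‖ ^ 2 := by
  simp [sqModulus, offset, expo₁, expo₂, cross, normal]
  refine ⟨?_, ?_, ?_, ?_, ?_, ?_⟩ <;> ring

lemma sqModulus_seven (y : ℂ) :
    sqModulus 7 (y, 0) 1 = 2 - ‖y‖ ^ 2 ∧ sqModulus 7 (y, 0) 2 = 4 - ‖y‖ ^ 2 ∧
    sqModulus 7 (y, 0) 3 = 8 - ‖y‖ ^ 2 ∧ sqModulus 7 (y, 0) 5 = 6 + ‖y‖ ^ 2 ∧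
    sqModulus 7 (y, 0) 6 = 2 + ‖y‖ ^ 2 := by
  simp [sqModulus, offset, expo₁, expo₂, cross, normal]
  refine ⟨?_, ?_, ?_, ?_, ?_⟩ <;> ring

lemma sqModulus_three (y : ℂ) :
    sqModulus 3 (y, 0) 0 = 6 ∧ sqModulus 3 (y, 0) 1 = 6 + ‖y‖ ^ 2 ∧
    sqModulus 3 (y, 0) 2 = 2 + ‖y‖ ^ 2 ∧ sqModulus 3 (y, 0) 5 = 2 - ‖y‖ ^ 2 ∧
    sqModulus 3 (y, 0) 6 = 4 - ‖y‖ ^ 2 ∧ sqModulus 3 (y, 0) 7 = 8 - ‖y‖ ^ 2 := by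
  simp [sqModulus, offset, expo₁, expo₂, cross, normal]
  refine ⟨?_, ?_, ?_, ?_, ?_, ?_⟩ <;> ring

lemma inChart_zero (γ t : ℝ) {y : ℂ} (hy : ‖y‖ ^ 2 < 2) :
    inChart γ t 0 (0, y) = (0, (1 - 2 * t) + profile (1 - 2 * t) (t * γ) y) := by
  obtain ⟨h2, h3, h5, h6, h7⟩ := sqModulus_zero y
  have p : (0 : ℝ) ≤ 2 + ‖y‖ ^ 2 := by positivity
  simp [inChart, ambient, slice, h2, h3, h5, h6, h7, profile,
    sqrt_f (sq_nonneg ‖y‖) hy.le, Real.sq_sqrt p]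
  ring

lemma inChart_four (γ t : ℝ) {y : ℂ} (hy : ‖y‖ ^ 2 < 2) :
    inChart γ t 4 (0, y) = (3, 2 * (1 - 2 * t) + profile (-(1 - 2 * t)) (t * γ) y) := by
  obtain ⟨h0, h1, h2, h3, h6, h7⟩ := sqModulus_four y
  have p : (0 : ℝ) ≤ 4 - ‖y‖ ^ 2 := by linarith
  simp [inChart, ambient, slice, h0, h1, h2, h3, h6, h7, profile,
    sqrt_f (sq_nonneg ‖y‖) hy.le, Real.sq_sqrt p]
  refine ⟨by norm_num, ?_⟩
  ring

/-- Around the other pole of the sphere `J = 0` the same polynomial `f` occurs, because `ζ * f ζ` is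
symmetric under `ζ ↦ 2 - ζ`; only the sign of the quadratic term changes. -/
lemma inChart_seven (γ t : ℝ) {y : ℂ} (hy : ‖y‖ ^ 2 < 2) :
    inChart γ t 7 (y, 0) = (0, 2 * (1 - 2 * t) + profile (-(1 - 2 * t)) (t * γ) y) := by
  obtain ⟨h1, h2, h3, h5, h6⟩ := sqModulus_seven y
  have p : (0 : ℝ) ≤ 4 - ‖y‖ ^ 2 := by linarith
  simp [inChart, ambient, slice, h1, h2, h3, h5, h6, profile,
    sqrt_f (sq_nonneg ‖y‖) hy.le, Real.sq_sqrt p]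
  ring

lemma inChart_three (γ t : ℝ) {y : ℂ} (hy : ‖y‖ ^ 2 < 2) :
    inChart γ t 3 (y, 0) = (3, (1 - 2 * t) + profile (1 - 2 * t) (t * γ) y) := by
  obtain ⟨h0, h1, h2, h5, h6, h7⟩ := sqModulus_three y
  have p : (0 : ℝ) ≤ 2 + ‖y‖ ^ 2 := by positivity
  simp [inChart, ambient, slice, h0, h1, h2, h5, h6, h7, profile,
    sqrt_f (sq_nonneg ‖y‖) hy.le, Real.sq_sqrt p]
  refine ⟨by norm_num, ?_⟩
  ring

/-! ### Criticality tests along the spheres and at their poles -/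

lemma coeff_ne_zero {γ t : ℝ} (hγ : 0 < γ) (h : t * γ = 0) : 1 - 2 * t ≠ 0 := by
  rw [(mul_eq_zero.1 h).resolve_right hγ.ne']
  norm_num

lemma hasFDerivAt_inChart_zero {γ t : ℝ} (hγ : 0 < γ) {w : ℂ} (hw : (0, w) ∈ V 0) :
    HasFDerivAt (inChart γ t 0) (0 : ℂ × ℂ →L[ℝ] ℝ × ℝ) (0, w) ↔ w.im = 0 ∧ eqU γ t w.re := by
  have h2 : ‖w‖ ^ 2 < 2 := by
    have := hw 7 (by decide)
    rw [(sqModulus_zero w).2.2.2.2] at this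
    linarith
  rw [hasFDerivAt_zero_iff_profile (coeff_ne_zero hγ) h2 (differentiableAt_local γ t hw)
    (fun x y => ?_) (fun y hy => inChart_zero γ t hy), eqU, mul_comm t γ]
  have hs : ∀ k, sqModulus 0 (-x, y) k = sqModulus 0 (x, y) k := fun k =>
    sqModulus_congr (norm_neg _) rfl
  simp [inChart, ambient, slice, hs]

lemma hasFDerivAt_inChart_four {γ t : ℝ} (hγ : 0 < γ) {w : ℂ} (hw : (0, w) ∈ V 4) :
    HasFDerivAt (inChart γ t 4) (0 : ℂ × ℂ →L[ℝ] ℝ × ℝ) (0, w) ↔ w.im = 0 ∧ eqV γ t w.re := by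
  have h2 : ‖w‖ ^ 2 < 2 := by
    have := hw 3 (by decide)
    rw [(sqModulus_four w).2.2.2.1] at this
    linarith
  rw [hasFDerivAt_zero_iff_profile (fun h => neg_ne_zero.2 (coeff_ne_zero hγ h)) h2
    (differentiableAt_local γ t hw)
    (fun x y => ?_) (fun y hy => inChart_four γ t hy), eqV, mul_comm t γ]
  have hs : ∀ k, sqModulus 4 (-x, y) k = sqModulus 4 (x, y) k := fun k =>
    sqModulus_congr (norm_neg _) rfl
  simp [inChart, ambient, slice, hs]

/-- In the charts `3` and `7` the sphere is the first coordinate axis, whereas the reduction to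
`profile` expects it to be the second. -/
lemma hasFDerivAt_swap_iff {G : ℂ × ℂ → ℝ × ℝ} :
    HasFDerivAt G (0 : ℂ × ℂ →L[ℝ] ℝ × ℝ) 0 ↔
      HasFDerivAt (G ∘ Prod.swap) (0 : ℂ × ℂ →L[ℝ] ℝ × ℝ) (0, 0) := by
  have hs : ∀ x, HasFDerivAt (Prod.swap : ℂ × ℂ → ℂ × ℂ) _ x := fun x =>
    (ContinuousLinearEquiv.prodComm ℝ ℂ ℂ).hasFDerivAt
  constructor
  · intro h
    have : HasFDerivAt G (0 : ℂ × ℂ →L[ℝ] ℝ × ℝ) (Prod.swap (0, 0)) := h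
    simpa using this.comp (0, 0) (hs _)
  · intro h
    have : HasFDerivAt (G ∘ Prod.swap) (0 : ℂ × ℂ →L[ℝ] ℝ × ℝ) (Prod.swap (0 : ℂ × ℂ)) := h
    simpa [Function.comp_assoc] using this.comp (0 : ℂ × ℂ) (hs _)

lemma f_zero : f 0 = 768 := by norm_num [f]

/-- At `w = 0` the profile equation reduces to `t * γ * f 0 = 0`, and `f 0` is not zero. -/
lemma hasFDerivAt_inChart_seven {γ t : ℝ} (hγ : 0 < γ) (hV : (0 : ℂ × ℂ) ∈ V 7) :
    HasFDerivAt (inChart γ t 7) (0 : ℂ × ℂ →L[ℝ] ℝ × ℝ) 0 ↔ t = 0 := by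
  have hd : DifferentiableAt ℝ (inChart γ t 7 ∘ Prod.swap) (0, 0) :=
    (differentiableAt_local γ t hV).comp (0, 0)
      (ContinuousLinearEquiv.prodComm ℝ ℂ ℂ).differentiableAt
  rw [hasFDerivAt_swap_iff, hasFDerivAt_zero_iff_profile
    (fun h => neg_ne_zero.2 (coeff_ne_zero hγ h)) (by simp) hd
    (fun x y => ?_) (fun y hy => inChart_seven γ t hy)]
  · simp [hγ.ne', f_zero]
  have hs : ∀ k, sqModulus 7 (y, -x) k = sqModulus 7 (y, x) k := fun k =>
    sqModulus_congr rfl (norm_neg _)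
  simp [inChart, ambient, slice, hs]

lemma hasFDerivAt_inChart_three {γ t : ℝ} (hγ : 0 < γ) (hV : (0 : ℂ × ℂ) ∈ V 3) :
    HasFDerivAt (inChart γ t 3) (0 : ℂ × ℂ →L[ℝ] ℝ × ℝ) 0 ↔ t = 0 := by
  have hd : DifferentiableAt ℝ (inChart γ t 3 ∘ Prod.swap) (0, 0) :=
    (differentiableAt_local γ t hV).comp (0, 0)
      (ContinuousLinearEquiv.prodComm ℝ ℂ ℂ).differentiableAt
  rw [hasFDerivAt_swap_iff, hasFDerivAt_zero_iff_profile (coeff_ne_zero hγ) (by simp) hd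
    (fun x y => ?_) (fun y hy => inChart_three γ t hy)]
  · simp [hγ.ne', f_zero]
  have hs : ∀ k, sqModulus 3 (y, -x) k = sqModulus 3 (y, x) k := fun k =>
    sqModulus_congr rfl (norm_neg _)
  simp [inChart, ambient, slice, hs]

/-! ### The fixed points -/

/-- Positive coordinates have phase `1`, so the representative is already normalised. -/
lemma realPoint_in_chart {x : Fin 8 → ℝ} {h} {ν : Fin 8} (hpos : ∀ k ∈ others ν, 0 < x k) :
    realPoint x h ∈ U ν ∧ chartFun ν (realPoint x h) = ((x ν : ℂ), (x (ν + 1) : ℂ)) := by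
  refine ⟨mk_mem_U.2 fun k hk => Complex.ofReal_ne_zero.2 (hpos k hk).ne', ?_⟩
  have : ∀ e : Fin 8 → ℤ, ∏ k ∈ others ν, phase (x k : ℂ) ^ e k = 1 := fun e =>
    Finset.prod_eq_one fun k hk => by rw [phase_ofReal (hpos k hk), one_zpow]
  change chartMap ν (fun k => (x k : ℂ)) = _
  simp only [chartMap, this, mul_one]

lemma A_in_chart : A ∈ U 6 ∧ chartFun 6 A = 0 := by
  have := realPoint_in_chart (ν := 6) (x := ![√2, √6, √6, 2 * √2, 2, √2, 0, 0])
    (h := by simp [mul_pow]; norm_num)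
    (fun k hk => by fin_cases k <;> first | exact absurd hk (by decide) | simp)
  exact ⟨this.1, this.2.trans (by simp)⟩

lemma B_in_chart : B ∈ U 1 ∧ chartFun 1 B = 0 := by
  have := realPoint_in_chart (ν := 1) (x := ![√2, 0, 0, √2, 2, 2 * √2, √6, √6])
    (h := by simp [mul_pow]; norm_num)
    (fun k hk => by fin_cases k <;> first | exact absurd hk (by decide) | simp)
  exact ⟨this.1, this.2.trans (by simp)⟩

lemma C_in_chart : C ∈ U 5 ∧ chartFun 5 C = 0 := by
  have := realPoint_in_chart (ν := 5) (x := ![2, 2 * √2, √6, √6, √2, 0, 0, √2])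
    (h := by simp [mul_pow]; norm_num)
    (fun k hk => by fin_cases k <;> first | exact absurd hk (by decide) | simp)
  exact ⟨this.1, this.2.trans (by simp)⟩

lemma D_in_chart : D ∈ U 2 ∧ chartFun 2 D = 0 := by
  have := realPoint_in_chart (ν := 2) (x := ![2, √2, 0, 0, √2, √6, √6, 2 * √2])
    (h := by simp [mul_pow]; norm_num)
    (fun k hk => by fin_cases k <;> first | exact absurd hk (by decide) | simp)
  exact ⟨this.1, this.2.trans (by simp)⟩

lemma pointP_in_chart {u : I₂} (hu : (u : ℝ) ^ 2 < 2) :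
    pointP u ∈ U 0 ∧ chartFun 0 (pointP u) = (0, ((u : ℝ) : ℂ)) := by
  have h0 := sq_nonneg (u : ℝ)
  have := realPoint_in_chart (ν := 0) (x := ![0, u, √(2 + u ^ 2), √(6 + u ^ 2), √6, √(8 - u ^ 2),
    √(4 - u ^ 2), √(2 - u ^ 2)]) (h := by
      simp
      rw [Real.sq_sqrt (by linarith), Real.sq_sqrt (by linarith), Real.sq_sqrt (by linarith),
        Real.sq_sqrt (by linarith), Real.sq_sqrt (by linarith)]
      refine ⟨?_, ?_, ?_, ?_, ?_⟩ <;> ring)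
    (fun k hk => by
      fin_cases k <;> first | exact absurd hk (by decide) | (simp <;> linarith))
  exact ⟨this.1, this.2.trans (by simp)⟩

lemma pointQ_in_chart {v : I₂} (hv : (v : ℝ) ^ 2 < 2) :
    pointQ v ∈ U 4 ∧ chartFun 4 (pointQ v) = (0, ((v : ℝ) : ℂ)) := by
  have h0 := sq_nonneg (v : ℝ)
  have := realPoint_in_chart (ν := 4) (x := ![√6, √(8 - v ^ 2), √(4 - v ^ 2), √(2 - v ^ 2), 0, v,
    √(2 + v ^ 2), √(6 + v ^ 2)]) (h := by
      simp
      rw [Real.sq_sqrt (by linarith), Real.sq_sqrt (by linarith), Real.sq_sqrt (by linarith),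
        Real.sq_sqrt (by linarith), Real.sq_sqrt (by linarith)]
      refine ⟨?_, ?_, ?_, ?_, ?_⟩ <;> ring)
    (fun k hk => by
      fin_cases k <;> first | exact absurd hk (by decide) | (simp <;> linarith))
  exact ⟨this.1, this.2.trans (by simp)⟩

lemma chartFun_eq_zero {z : levelSet} {ν : Fin 8} (h1 : z.1 ν = 0) (h2 : z.1 (ν + 1) = 0) :
    chartFun ν (M.mk z) = 0 := by
  change chartMap ν z.1 = 0
  rw [chartMap, h1, h2, zero_mul, zero_mul]
  rfl

lemma pointP_at_end {u : I₂} (hu : (u : ℝ) ^ 2 = 2) :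
    pointP u ∈ U 7 ∧ chartFun 7 (pointP u) = 0 := by
  have hne : (u : ℝ) ≠ 0 := fun h => by norm_num [h] at hu
  refine ⟨mk_mem_U.2 fun k hk => Complex.ofReal_ne_zero.2 ?_, ?_⟩
  · fin_cases k <;> first | exact absurd hk (by decide) | (norm_num [hu, hne])
  · exact chartFun_eq_zero (by simp [hu]) (by simp)

lemma pointQ_at_end {v : I₂} (hv : (v : ℝ) ^ 2 = 2) :
    pointQ v ∈ U 3 ∧ chartFun 3 (pointQ v) = 0 := by
  have hne : (v : ℝ) ≠ 0 := fun h => by norm_num [h] at hv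
  refine ⟨mk_mem_U.2 fun k hk => Complex.ofReal_ne_zero.2 ?_, ?_⟩
  · fin_cases k <;> first | exact absurd hk (by decide) | (norm_num [hv, hne])
  · exact chartFun_eq_zero (by simp [hv]) (by simp)

/-- Both points are the centre of chart `7`. In particular the parameters `√2` and `-√2` give one
point of `M`. -/
lemma pointP_eq_of_sq {u v : I₂} (hu : (u : ℝ) ^ 2 = 2) (hv : (v : ℝ) ^ 2 = 2) :
    pointP u = pointP v :=
  chartFun_injOn 7 (pointP_at_end hu).1 (pointP_at_end hv).1
    ((pointP_at_end hu).2.trans (pointP_at_end hv).2.symm)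

lemma pointQ_eq_of_sq {u v : I₂} (hu : (u : ℝ) ^ 2 = 2) (hv : (v : ℝ) ^ 2 = 2) :
    pointQ u = pointQ v :=
  chartFun_injOn 3 (pointQ_at_end hu).1 (pointQ_at_end hv).1
    ((pointQ_at_end hu).2.trans (pointQ_at_end hv).2.symm)

/-- As `f 2 = 0`, only the term with `deriv f 2`, which is nonzero, survives. So the equation agrees
with the criterion at the pole, although it was derived away from it. -/
lemma eqU_end_iff {γ t u : ℝ} (hγ : 0 < γ) (hu : u ^ 2 = 2) : eqU γ t u ↔ t = 0 := by
  rw [eqU, hu, (hasDerivAt_f 2).deriv]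
  norm_num [f, hγ.ne']

lemma eqV_end_iff {γ t v : ℝ} (hγ : 0 < γ) (hv : v ^ 2 = 2) : eqV γ t v ↔ t = 0 := by
  rw [eqV_iff, eqU_end_iff hγ (by simpa using hv)]

lemma isFixedPoint_pointP {γ t : ℝ} (hγ : 0 < γ) (u : I₂) :
    IsFixedPoint (Ft γ t) (pointP u) ↔ eqU γ t u := by
  rcases (sq_le_two u).lt_or_eq with h | h
  · obtain ⟨h1, h2⟩ := pointP_in_chart h
    have hV := chartFun_mem h1
    rw [h2] at hV
    rw [isFixedPoint_Ft_iff h1, h2, hasFDerivAt_inChart_zero hγ hV]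
    simp
  · obtain ⟨h1, h2⟩ := pointP_at_end h
    rw [isFixedPoint_Ft_iff h1, h2, hasFDerivAt_inChart_seven hγ (h2 ▸ chartFun_mem h1),
      eqU_end_iff hγ h]

lemma isFixedPoint_pointQ {γ t : ℝ} (hγ : 0 < γ) (v : I₂) :
    IsFixedPoint (Ft γ t) (pointQ v) ↔ eqV γ t v := by
  rcases (sq_le_two v).lt_or_eq with h | h
  · obtain ⟨h1, h2⟩ := pointQ_in_chart h
    have hV := chartFun_mem h1
    rw [h2] at hV
    rw [isFixedPoint_Ft_iff h1, h2, hasFDerivAt_inChart_four hγ hV]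
    simp
  · obtain ⟨h1, h2⟩ := pointQ_at_end h
    rw [isFixedPoint_Ft_iff h1, h2, hasFDerivAt_inChart_three hγ (h2 ▸ chartFun_mem h1),
      eqV_end_iff hγ h]

lemma mem_I₂_of_sq {x : ℝ} (h : x ^ 2 ≤ 2) : x ∈ I₂ :=
  abs_le.1 (Real.abs_le_sqrt h)

lemma sqrt_two_mem : √2 ∈ I₂ := mem_I₂_of_sq (by norm_num)

/-- A fixed point on the sphere `J = 0`. -/
lemma exists_pointP {γ t : ℝ} (hγ : 0 < γ) {z : levelSet} (h0 : z.1 0 = 0)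
    (hz : M.mk z ∈ U 0 ∨ M.mk z ∈ U 7) (h : IsFixedPoint (Ft γ t) (M.mk z)) :
    ∃ u : I₂, M.mk z = pointP u := by
  have main : M.mk z ∈ U 0 → ∃ u : I₂, M.mk z = pointP u := by
    intro hz
    rw [isFixedPoint_Ft_iff hz] at h
    have hm := chartFun_mem hz
    obtain ⟨w, hw⟩ : ∃ w, chartFun 0 (M.mk z) = (0, w) :=
      ⟨(chartFun 0 (M.mk z)).2, Prod.ext (by
        change z.1 0 * _ = 0
        rw [h0, zero_mul]) rfl⟩
    rw [hw] at h hm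
    have him := ((hasFDerivAt_inChart_zero hγ hm).1 h).1
    have e : w = (w.re : ℂ) := Complex.ext rfl (by simpa using him)
    have h2 : w.re ^ 2 < 2 := by
      have := hm 7 (by decide)
      rw [(sqModulus_zero w).2.2.2.2, e, Complex.norm_real, Real.norm_eq_abs, sq_abs] at this
      linarith
    obtain ⟨p1, p2⟩ := pointP_in_chart (u := ⟨w.re, mem_I₂_of_sq h2.le⟩) h2
    exact ⟨_, chartFun_injOn 0 hz p1 (by rw [hw, p2, ← e])⟩
  rcases hz with hz | hz
  · exact main hz
  -- Either the point is the pole, or it already lies in the domain of chart `0`.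
  · by_cases h7 : z.1 7 = 0
    · have p := pointP_at_end (u := ⟨√2, sqrt_two_mem⟩) (by norm_num)
      exact ⟨_, chartFun_injOn 7 hz p.1 ((chartFun_eq_zero h7 h0).trans p.2.symm)⟩
    · refine main (mk_mem_U.2 fun k hk => ?_)
      by_cases hk7 : k = 7
      · rwa [hk7]
      · exact mk_mem_U.1 hz k (mem_others.2 ⟨hk7, (mem_others.1 hk).1⟩)

/-- A fixed point on the sphere `J = 3`. -/
lemma exists_pointQ {γ t : ℝ} (hγ : 0 < γ) {z : levelSet} (h0 : z.1 4 = 0)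
    (hz : M.mk z ∈ U 4 ∨ M.mk z ∈ U 3) (h : IsFixedPoint (Ft γ t) (M.mk z)) :
    ∃ v : I₂, M.mk z = pointQ v := by
  have main : M.mk z ∈ U 4 → ∃ v : I₂, M.mk z = pointQ v := by
    intro hz
    rw [isFixedPoint_Ft_iff hz] at h
    have hm := chartFun_mem hz
    obtain ⟨w, hw⟩ : ∃ w, chartFun 4 (M.mk z) = (0, w) :=
      ⟨(chartFun 4 (M.mk z)).2, Prod.ext (by
        change z.1 4 * _ = 0
        rw [h0, zero_mul]) rfl⟩
    rw [hw] at h hm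
    have him := ((hasFDerivAt_inChart_four hγ hm).1 h).1
    have e : w = (w.re : ℂ) := Complex.ext rfl (by simpa using him)
    have h2 : w.re ^ 2 < 2 := by
      have := hm 3 (by decide)
      rw [(sqModulus_four w).2.2.2.1, e, Complex.norm_real, Real.norm_eq_abs, sq_abs] at this
      linarith
    obtain ⟨p1, p2⟩ := pointQ_in_chart (v := ⟨w.re, mem_I₂_of_sq h2.le⟩) h2
    exact ⟨_, chartFun_injOn 4 hz p1 (by rw [hw, p2, ← e])⟩
  rcases hz with hz | hz
  · exact main hz
  · by_cases h3 : z.1 3 = 0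
    · have p := pointQ_at_end (v := ⟨√2, sqrt_two_mem⟩) (by norm_num)
      exact ⟨_, chartFun_injOn 3 hz p.1 ((chartFun_eq_zero h3 h0).trans p.2.symm)⟩
    · refine main (mk_mem_U.2 fun k hk => ?_)
      by_cases hk3 : k = 3
      · rwa [hk3]
      · exact mk_mem_U.1 hz k (mem_others.2 ⟨hk3, (mem_others.1 hk).1⟩)

theorem isFixedPoint_Ft_iff_exists {γ t : ℝ} (hγ : 0 < γ) (p : M) :
    IsFixedPoint (Ft γ t) p ↔ p = A ∨ p = B ∨ p = C ∨ p = D ∨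
      (∃ u : I₂, eqU γ t u ∧ p = pointP u) ∨ ∃ v : I₂, eqV γ t v ∧ p = pointQ v := by
  constructor
  · intro h
    obtain ⟨ν, hν⟩ := exists_mem_U p
    obtain ⟨z, rfl⟩ := p.mk_surj
    have hP : z.1 0 = 0 → M.mk z ∈ U 0 ∨ M.mk z ∈ U 7 →
        ∃ u : I₂, eqU γ t u ∧ M.mk z = pointP u := fun h0 hz => by
      obtain ⟨u, hu⟩ := exists_pointP hγ h0 hz h
      exact ⟨u, (isFixedPoint_pointP hγ u).1 (hu ▸ h), hu⟩
    have hQ : z.1 4 = 0 → M.mk z ∈ U 4 ∨ M.mk z ∈ U 3 →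
        ∃ v : I₂, eqV γ t v ∧ M.mk z = pointQ v := fun h0 hz => by
      obtain ⟨v, hv⟩ := exists_pointQ hγ h0 hz h
      exact ⟨v, (isFixedPoint_pointQ hγ v).1 (hv ▸ h), hv⟩
    obtain ⟨c1, c2⟩ := coordinates_of_isFixedPoint hν h
    have vertex : ∀ q : M, q ∈ U ν ∧ chartFun ν q = 0 → expo₁ ν 0 ≠ 0 → expo₂ ν 0 ≠ 0 →
        M.mk z = q := fun q hq n1 n2 =>
      chartFun_injOn ν hν hq.1
        ((chartFun_eq_zero (c1.resolve_left n1) (c2.resolve_left n2)).trans hq.2.symm)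
    -- The charts `1`, `2`, `5`, `6` have two nonzero exponents and contribute their centres; `0`,
    -- `7` meet the sphere `J = 0`, and `3`, `4` the sphere `J = 3`.
    fin_cases ν
    · exact .inr <| .inr <| .inr <| .inr <| .inl <| hP (c1.resolve_left (by decide)) (.inl hν)
    · exact .inr <| .inl <| vertex B B_in_chart (by decide) (by decide)
    · exact .inr <| .inr <| .inr <| .inl <| vertex D D_in_chart (by decide) (by decide)
    · exact .inr <| .inr <| .inr <| .inr <| .inr <| hQ (c2.resolve_left (by decide)) (.inr hν)
    · exact .inr <| .inr <| .inr <| .inr <| .inr <| hQ (c1.resolve_left (by decide)) (.inl hν)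
    · exact .inr <| .inr <| .inl <| vertex C C_in_chart (by decide) (by decide)
    · exact .inl <| vertex A A_in_chart (by decide) (by decide)
    · exact .inr <| .inr <| .inr <| .inr <| .inl <| hP (c2.resolve_left (by decide)) (.inr hν)
  · rintro (rfl | rfl | rfl | rfl | ⟨u, hu, rfl⟩ | ⟨v, hv, rfl⟩)
    · exact isFixedPoint_of_vertex (by decide) γ t A_in_chart.1 A_in_chart.2
    · exact isFixedPoint_of_vertex (by decide) γ t B_in_chart.1 B_in_chart.2
    · exact isFixedPoint_of_vertex (by decide) γ t C_in_chart.1 C_in_chart.2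
    · exact isFixedPoint_of_vertex (by decide) γ t D_in_chart.1 D_in_chart.2
    · exact (isFixedPoint_pointP hγ u).2 hu
    · exact (isFixedPoint_pointQ hγ v).2 hv

/-! ### Distinctness -/

lemma JH_values : (J A = 1 ∧ H A = 3) ∧ (J B = 1 ∧ H B = 0) ∧ (J C = 2 ∧ H C = 3) ∧
    (J D = 2 ∧ H D = 0) := by
  have h : ∀ x hx, J (realPoint x hx) = x 0 ^ 2 / 2 ∧ H (realPoint x hx) = x 2 ^ 2 / 2 :=
    fun x hx => by simp [J, H, modulus, realPoint, M.lift_mk]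
  simp [A, B, C, D, h]
  norm_num

lemma J_pointP (u : I₂) : J (pointP u) = 0 := by
  simp [J, modulus, pointP, realPoint, M.lift_mk]

lemma J_pointQ (v : I₂) : J (pointQ v) = 3 := by
  norm_num [J, modulus, pointQ, realPoint, M.lift_mk]

lemma sq_eq_of_pointP_eq {u v : I₂} (h : pointP u = pointP v) : (u : ℝ) ^ 2 = (v : ℝ) ^ 2 := by
  have h := congrArg (modulus 1) h
  simpa [modulus, pointP, realPoint, M.lift_mk, sq_eq_sq_iff_abs_eq_abs] using h

lemma sq_eq_of_pointQ_eq {u v : I₂} (h : pointQ u = pointQ v) : (u : ℝ) ^ 2 = (v : ℝ) ^ 2 := by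
  have h := congrArg (modulus 5) h
  simpa [modulus, pointQ, realPoint, M.lift_mk, sq_eq_sq_iff_abs_eq_abs] using h

/-- The strict inequality excludes the pole, where the parametrisation identifies `√2` with `-√2`.
-/
lemma eq_of_pointP_eq {u v : I₂} (hu : (u : ℝ) ^ 2 < 2) (h : pointP u = pointP v) : u = v := by
  have hv : (v : ℝ) ^ 2 < 2 := sq_eq_of_pointP_eq h ▸ hu
  have := congrArg (chartFun 0) h
  rw [(pointP_in_chart hu).2, (pointP_in_chart hv).2] at this
  simpa [Subtype.ext_iff] using this

lemma eq_of_pointQ_eq {u v : I₂} (hu : (u : ℝ) ^ 2 < 2) (h : pointQ u = pointQ v) : u = v := by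
  have hv : (v : ℝ) ^ 2 < 2 := sq_eq_of_pointQ_eq h ▸ hu
  have := congrArg (chartFun 4) h
  rw [(pointQ_in_chart hu).2, (pointQ_in_chart hv).2] at this
  simpa [Subtype.ext_iff] using this

/-- `J` takes the values `1, 1, 2, 2, 0, 0, 3, 3`; within the pairs `A, B` and `C, D` the points are
separated by `H`. -/
lemma ncard_eight {p p' q q' : M} (hp : J p = 0) (hp' : J p' = 0) (hq : J q = 3) (hq' : J q' = 3)
    (hpp : p ≠ p') (hqq : q ≠ q') : ({A, B, C, D, p, p', q, q'} : Set M).ncard = 8 := by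
  have ne : ∀ {g : M → ℝ} {a b : M} {r s : ℝ}, g a = r → g b = s → r ≠ s → a ≠ b := by
    rintro g a b _ _ rfl rfl h rfl
    exact h rfl
  obtain ⟨⟨jA, hA⟩, ⟨jB, hB⟩, ⟨jC, hC⟩, ⟨jD, hD⟩⟩ := JH_values
  have eAB : A ≠ B := ne hA hB (by norm_num)
  have eCD : C ≠ D := ne hC hD (by norm_num)
  have n : ∀ {a b : M} {r s : ℝ}, J a = r → J b = s → r ≠ s → a ≠ b := fun h1 h2 => ne h1 h2
  have n12 : (1 : ℝ) ≠ 2 := by norm_num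
  have n13 : (1 : ℝ) ≠ 3 := by norm_num
  have n23 : (2 : ℝ) ≠ 3 := by norm_num
  have n03 : (0 : ℝ) ≠ 3 := by norm_num
  repeat rw [Set.ncard_insert_of_notMem]
  · simp
  · simpa using hqq
  · simp [n hp' hq n03, n hp' hq' n03]
  · simp [hpp, n hp hq n03, n hp hq' n03]
  · simp [n jD hp two_ne_zero, n jD hp' two_ne_zero, n jD hq n23, n jD hq' n23]
  · simp [eCD, n jC hp two_ne_zero, n jC hp' two_ne_zero, n jC hq n23, n jC hq' n23]
  · simp [n jB jC n12, n jB jD n12, n jB hp one_ne_zero, n jB hp' one_ne_zero, n jB hq n13,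
      n jB hq' n13]
  · simp [eAB, n jA jC n12, n jA jD n12, n jA hp one_ne_zero, n jA hp' one_ne_zero, n jA hq n13,
      n jA hq' n13]

/-! ### Initial points and uniqueness of the smooth branches -/

lemma sqrt_eight : √8 = 2 * √2 := by
  rw [show (8 : ℝ) = 2 ^ 2 * 2 by norm_num, Real.sqrt_mul (by norm_num),
    Real.sqrt_sq (by norm_num)]

lemma pointP_zero {u : I₂} (hu : (u : ℝ) = 0) : pointP u = Pmin := by
  simp only [pointP, Pmin, hu]
  congr 1
  norm_num [sqrt_eight]

lemma pointP_sqrt_two {u : I₂} (hu : (u : ℝ) = √2) : pointP u = Pmax := by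
  simp only [pointP, Pmax, hu]
  congr 1
  norm_num [sqrt_eight]

lemma pointQ_zero {v : I₂} (hv : (v : ℝ) = 0) : pointQ v = Qmax := by
  simp only [pointQ, Qmax, hv]
  congr 1
  norm_num [sqrt_eight]

lemma pointQ_neg_sqrt_two {v : I₂} (hv : (v : ℝ) = -√2) : pointQ v = Qmin := by
  -- `Qmin` is written with `+√2` in the sixth coordinate; at the pole the sign of the parameter
  -- does not matter.
  rw [pointQ_eq_of_sq (v := ⟨√2, sqrt_two_mem⟩) (by rw [hv]; norm_num) (by norm_num)]
  simp only [pointQ, Qmin]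
  congr 1
  norm_num [sqrt_eight]

/-- A continuous selection from two branches that avoid `0` on `(0, 1]`. -/
lemma eq_branch {u : Set.Icc (0 : ℝ) 1 → ℝ} {g m p : ℝ → ℝ} (hg : ∀ t, u t = g t)
    (hgc : ContinuousOn g (Set.Icc 0 1)) (hm : ContinuousOn m (Set.Icc 0 1))
    (hp : ContinuousOn p (Set.Icc 0 1)) (hneg : ∀ t ∈ Set.Ioc (0 : ℝ) 1, m t < 0)
    (hpos : ∀ t ∈ Set.Ioc (0 : ℝ) 1, 0 < p t)
    (h : ∀ t ∈ Set.Ioc (0 : ℝ) 1, g t = m t ∨ g t = p t) :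
    (∀ t, u t = m t) ∨ ∀ t, u t = p t := by
  have sub : Set.Ioc (0 : ℝ) 1 ⊆ Set.Icc 0 1 := Set.Ioc_subset_Icc_self
  have ext : ∀ b : ℝ → ℝ, ContinuousOn b (Set.Icc 0 1) → Set.EqOn g b (Set.Ioc 0 1) →
      ∀ t, u t = b t := by
    intro b hb hgb t
    rw [hg]
    refine Set.EqOn.of_subset_closure hgb hgc hb sub ?_ t.2
    rw [closure_Ioc zero_ne_one]
  have hne : ∀ t ∈ Set.Ioc (0 : ℝ) 1, g t ≠ 0 := fun t ht => by
    rcases h t ht with e | e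
    · rw [e]; exact (hneg t ht).ne
    · rw [e]; exact (hpos t ht).ne'
  have one : (1 : ℝ) ∈ Set.Ioc (0 : ℝ) 1 := by simp
  -- A change of sign would force a zero of `g` in `(0, 1]`, so the branch met at `t = 1` is kept
  -- throughout; the closure argument then adds `t = 0`.
  have sign : ∀ t ∈ Set.Ioc (0 : ℝ) 1, 0 < g 1 * g t := by
    intro t ht
    by_contra! hle
    have hc : ContinuousOn (fun s => g 1 * g s) (Set.Icc t 1) :=
      continuousOn_const.mul (hgc.mono (Set.Icc_subset_Icc_left ht.1.le))
    obtain ⟨s, hs, h0⟩ := intermediate_value_Icc ht.2 hc ⟨hle, (mul_self_nonneg (g 1))⟩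
    rcases mul_eq_zero.1 h0 with h0 | h0
    · exact hne 1 one h0
    · exact hne s ⟨ht.1.trans_le hs.1, hs.2⟩ h0
  rcases h 1 one with e | e
  · refine .inl (ext m hm fun t ht => (h t ht).resolve_right fun e' => ?_)
    have := sign t ht
    rw [e, e'] at this
    nlinarith [hneg 1 one, hpos t ht]
  · refine .inr (ext p hp fun t ht => (h t ht).resolve_left fun e' => ?_)
    have := sign t ht
    rw [e, e'] at this
    nlinarith [hpos 1 one, hneg t ht]

/-- The smooth solutions are exactly the two branches. -/
theorem smoothSolutions_eq {E : ℝ → ℝ → Prop} {m p : Set.Icc (0 : ℝ) 1 → I₂} {m' p' : ℝ → ℝ}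
    (em : ∀ t, (m t : ℝ) = m' t) (ep : ∀ t, (p t : ℝ) = p' t)
    (hm : ContDiffOn ℝ ∞ m' (Set.Icc 0 1)) (hp : ContDiffOn ℝ ∞ p' (Set.Icc 0 1))
    (hneg : ∀ t ∈ Set.Ioc (0 : ℝ) 1, m' t < 0) (hpos : ∀ t ∈ Set.Ioc (0 : ℝ) 1, 0 < p' t)
    (hE0 : E 0 (m 0) ∧ E 0 (p 0))
    (hE : ∀ t ∈ Set.Ioc (0 : ℝ) 1, ∀ u ∈ I₂, E t u ↔ u = m' t ∨ u = p' t) :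
    {u | IsSmoothSolution E u} = {m, p} := by
  have sol : ∀ (b : Set.Icc (0 : ℝ) 1 → I₂) (b' : ℝ → ℝ), (∀ t, (b t : ℝ) = b' t) →
      ContDiffOn ℝ ∞ b' (Set.Icc 0 1) → E 0 (b 0) →
      (∀ t ∈ Set.Ioc (0 : ℝ) 1, b' t = m' t ∨ b' t = p' t) → IsSmoothSolution E b := by
    intro b b' e hb h0 h
    refine ⟨hb.congr fun t ht => ?_, fun t => ?_⟩
    · rw [Set.IccExtend_of_mem _ _ ht]
      exact e _
    · rcases t.2.1.eq_or_lt with h' | h'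
      · have : t = 0 := Subtype.ext h'.symm
        rw [this]; exact h0
      · refine (hE t ⟨h', t.2.2⟩ _ (b t).2).2 ?_
        rw [e]
        exact h t ⟨h', t.2.2⟩
  ext u
  simp only [Set.mem_ofPred_eq, Set.mem_insert_iff, Set.mem_singleton_iff]
  constructor
  · rintro ⟨hs, hu⟩
    have hg : ∀ t : Set.Icc (0 : ℝ) 1,
        (u t : ℝ) = Set.IccExtend zero_le_one (fun t : Set.Icc (0 : ℝ) 1 => (u t : ℝ)) t :=
      fun t => (Set.IccExtend_val zero_le_one (fun t : Set.Icc (0 : ℝ) 1 => (u t : ℝ)) t).symm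
    rcases eq_branch hg hs.continuousOn hm.continuousOn hp.continuousOn hneg hpos
      (fun t ht => by
        have ht' := Set.Ioc_subset_Icc_self ht
        rw [Set.IccExtend_of_mem _ _ ht']
        exact (hE t ht _ (u ⟨t, ht'⟩).2).1 (hu ⟨t, ht'⟩)) with h | h
    · exact .inl (funext fun t => Subtype.ext ((h t).trans (em t).symm))
    · exact .inr (funext fun t => Subtype.ext ((h t).trans (ep t).symm))
  · rintro (rfl | rfl)
    · exact sol _ _ em hm hE0.1 fun t _ => .inl rfl
    · exact sol _ _ ep hp hE0.2 fun t _ => .inr rfl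

end OctagonSystem

end

/-! ### Assembly of the theorem -/

open OctagonSystem
theorem mainTheorem4 (γ : ℝ) (hγ : 0 < γ) :
    ∃ uMinus uPlus vMinus vPlus : Set.Icc (0 : ℝ) 1 → I₂,
      -- the smooth solutions of the two equations
      {u | IsSmoothSolution (eqU γ) u} = {uMinus, uPlus} ∧
      (uMinus 0 : ℝ) = 0 ∧ (uPlus 0 : ℝ) = √2 ∧
      {v | IsSmoothSolution (eqV γ) v} = {vMinus, vPlus} ∧
      (vMinus 0 : ℝ) = -√2 ∧ (vPlus 0 : ℝ) = 0 ∧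
      -- the eight fixed points
      (∀ t : Set.Icc (0 : ℝ) 1,
        {p | IsFixedPoint (Ft γ t) p} =
          {A, B, C, D, pointP (uMinus t), pointP (uPlus t), pointQ (vMinus t), pointQ (vPlus t)} ∧
        {p | IsFixedPoint (Ft γ t) p}.ncard = 8) ∧
      -- the toric fixed points are recovered for `t = 0`
      pointP (uMinus 0) = Pmin ∧ pointP (uPlus 0) = Pmax ∧
      pointQ (vMinus 0) = Qmin ∧ pointQ (vPlus 0) = Qmax := by
  obtain ⟨m, p, m0, p0, ms, ps, hmp⟩ := exists_branches hγ
  have s2 : (0 : ℝ) < √2 := by positivity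
  have neg_mem : ∀ {x : ℝ}, x ∈ I₂ → -x ∈ I₂ := fun h => ⟨neg_le_neg h.2, by linarith [h.1]⟩
  have hmI : ∀ t : Set.Icc (0 : ℝ) 1, m t ∈ I₂ := fun t => by
    rcases t.2.1.eq_or_lt with h | h
    · rw [← h, m0]; exact ⟨by linarith, s2.le⟩
    · have := (hmp t ⟨h, t.2.2⟩).1
      exact ⟨this.1.le, by linarith [this.2]⟩
  have hpI : ∀ t : Set.Icc (0 : ℝ) 1, p t ∈ I₂ := fun t => by
    rcases t.2.1.eq_or_lt with h | h
    · rw [← h, p0]; exact sqrt_two_mem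
    · have := (hmp t ⟨h, t.2.2⟩).2.1
      exact ⟨by linarith [this.1], this.2.le⟩
  have hmU : ∀ t : Set.Icc (0 : ℝ) 1, eqU γ t (m t) := fun t => by
    rcases t.2.1.eq_or_lt with h | h
    · rw [← h, m0]; exact (eqU_zero_iff ⟨by linarith, s2.le⟩).2 (.inl rfl)
    · exact ((hmp t ⟨h, t.2.2⟩).2.2 _ (hmI t)).2 (.inl rfl)
  have hpU : ∀ t : Set.Icc (0 : ℝ) 1, eqU γ t (p t) := fun t => by
    rcases t.2.1.eq_or_lt with h | h
    · rw [← h, p0]; exact (eqU_zero_iff sqrt_two_mem).2 (.inr (.inl rfl))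
    · exact ((hmp t ⟨h, t.2.2⟩).2.2 _ (hpI t)).2 (.inr rfl)
  -- up to the sign at the pole `u² = 2`, the two branches are all solutions
  have all : ∀ (t : Set.Icc (0 : ℝ) 1) (u : ℝ), u ∈ I₂ → eqU γ t u →
      u = m t ∨ u = p t ∨ (u ^ 2 = 2 ∧ p t ^ 2 = 2) := by
    intro t u hu h
    rcases t.2.1.eq_or_lt with h' | h'
    · rw [← h'] at h ⊢
      rw [m0, p0]
      rcases (eqU_zero_iff hu).1 h with h | h | h
      · exact .inl h
      · exact .inr (.inl h)
      · exact .inr (.inr (by rw [h]; norm_num))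
    · rcases ((hmp t ⟨h', t.2.2⟩).2.2 u hu).1 h with h | h
      · exact .inl h
      · exact .inr (.inl h)
  have sq_lt : ∀ t : Set.Icc (0 : ℝ) 1, m t ^ 2 < 2 := fun t => by
    have hs : √2 ^ 2 = (2 : ℝ) := by norm_num
    rcases t.2.1.eq_or_lt with h | h
    · rw [← h, m0]; norm_num
    · have := (hmp t ⟨h, t.2.2⟩).1
      nlinarith [this.1, this.2]
  have ne : ∀ t : Set.Icc (0 : ℝ) 1, m t ≠ p t := fun t => by
    rcases t.2.1.eq_or_lt with h | h
    · rw [← h, m0, p0]; exact s2.ne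
    · have := hmp t ⟨h, t.2.2⟩
      exact (this.1.2.trans this.2.1.1).ne
  -- The reflection `v = -u` exchanges the order of the branches: `vMinus` is `-uPlus` and `vPlus`
  -- is `-uMinus`.
  refine ⟨fun t => ⟨m t, hmI t⟩, fun t => ⟨p t, hpI t⟩, fun t => ⟨-p t, neg_mem (hpI t)⟩,
    fun t => ⟨-m t, neg_mem (hmI t)⟩, ?_, m0, p0, ?_, by simp [p0], by simp [m0],
    fun t => ?_, pointP_zero m0, pointP_sqrt_two p0, pointQ_neg_sqrt_two (by simp [p0]),
    pointQ_zero (by simp [m0])⟩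
  · exact smoothSolutions_eq (fun _ => rfl) (fun _ => rfl) ms ps (fun t ht => (hmp t ht).1.2)
      (fun t ht => (hmp t ht).2.1.1) ⟨hmU 0, hpU 0⟩ fun t ht => (hmp t ht).2.2
  · refine smoothSolutions_eq (m' := fun t => -p t) (p' := fun t => -m t) (fun _ => rfl)
      (fun _ => rfl) ps.neg ms.neg (fun t ht => neg_neg_iff_pos.2 (hmp t ht).2.1.1)
      (fun t ht => neg_pos.2 (hmp t ht).1.2) ?_ fun t ht v hv => ?_
    · simp only [eqV_iff, neg_neg]
      exact ⟨hpU 0, hmU 0⟩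
    · rw [eqV_iff, (hmp t ht).2.2 _ (neg_mem hv), neg_eq_iff_eq_neg, neg_eq_iff_eq_neg, or_comm]
  · have hset : {q | IsFixedPoint (Ft γ t) q} = {A, B, C, D, pointP ⟨m t, hmI t⟩,
        pointP ⟨p t, hpI t⟩, pointQ ⟨-p t, neg_mem (hpI t)⟩, pointQ ⟨-m t, neg_mem (hmI t)⟩} := by
      ext q
      simp only [Set.mem_ofPred_eq, Set.mem_insert_iff, Set.mem_singleton_iff,
        isFixedPoint_Ft_iff_exists hγ]
      refine or_congr_right <| or_congr_right <| or_congr_right <| or_congr_right ?_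
      constructor
      · rintro (⟨u, hu, rfl⟩ | ⟨v, hv, rfl⟩)
        · rcases all t u u.2 hu with h | h | ⟨h, h'⟩
          · exact .inl (congrArg pointP (Subtype.ext h))
          · exact .inr (.inl (congrArg pointP (Subtype.ext h)))
          · exact .inr (.inl (pointP_eq_of_sq h h'))
        · rcases all t (-v) (neg_mem v.2) ((eqV_iff γ t v).1 hv) with h | h | ⟨h, h'⟩
          · exact .inr (.inr (.inr (congrArg pointQ (Subtype.ext (neg_eq_iff_eq_neg.1 h)))))
          · exact .inr (.inr (.inl (congrArg pointQ (Subtype.ext (neg_eq_iff_eq_neg.1 h)))))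
          · exact .inr (.inr (.inl (pointQ_eq_of_sq (by simpa using h) (by simpa using h'))))
      · rintro (rfl | rfl | rfl | rfl)
        · exact .inl ⟨_, hmU t, rfl⟩
        · exact .inl ⟨_, hpU t, rfl⟩
        · exact .inr ⟨_, (eqV_iff γ t _).2 (by simpa using hpU t), rfl⟩
        · exact .inr ⟨_, (eqV_iff γ t _).2 (by simpa using hmU t), rfl⟩
    refine ⟨hset, ?_⟩
    rw [hset]
    refine ncard_eight (J_pointP _) (J_pointP _) (J_pointQ _) (J_pointQ _) (fun h => ?_)
      (fun h => ?_)
    · exact ne t (congrArg Subtype.val (eq_of_pointP_eq (sq_lt t) h))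
    -- The equality is reversed because the strict bound holds for `-m t`, while `-p t` is at the
    -- pole for `t = 0`.
    · have := congrArg Subtype.val (eq_of_pointQ_eq (by simpa using sq_lt t) h.symm)
      exact ne t (neg_injective this)
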